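/- Let $k$ be a field and $\Lambda$ a finite dimensional Hopf algebra over $k$ which is split (the endomorphism algebra of every simple module is $k$) and basic (every simple module has multiplicity one in $\Lambda/\operatorname{rad}\Lambda$). Then the set $\mathcal S$ of isomorphism classes of simple $\Lambda$-modules is a group under the tensor product over $k$ (with $\Lambda$ acting through the comultiplication); assume that this structure group $\mathcal S$ is abelian. Let $K_0(\Lambda)$ be the ring given by the free abelian group on the isomorphism classes $[M]$ of finitely generated $\Lambda$-modules, with $[M][N]=[M\otimes N]$, modulo the relations $[X_2]=[X_1]+[X_3]$ for all split exact sequences $0\to X_1\to X_2\to X_3\to 0$, and let $K_0^p(\Lambda)$ be the subring generated by the classes of the projective and of the semisimple modules. For $S\in\mathcal S$ let $P_S$ be the projective cover of $S$, let $P_1$ be the projective cover of the trivial module $k_\varepsilon$, and let $c\in\mathbb Z\mathcal S$ be the sum of the classes of the quotients of a composition series of $P_1$. Then $R=\mathbb C\otimes_{\mathbb Z}K_0^p(\Lambda)$ is commutative, the $\mathbb C$-span $I$ of the classes of the projective modules is an ideal of $R$, and the linear map $\Phi:\mathbb C\mathcal S\to I$ with $\Phi(S)=1\otimes[P_S]$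 for $S\in\mathcal S$ is bijective and satisfies $\Phi(t_1)\Phi(t_2)=\Phi(t_1\,c\,t_2)$; that is, $I$ is isomorphic to $\mathbb C\mathcal S$ with the product $t_1\cdot t_2=t_1ct_2$. Moreover, let $K_1,\dots,K_t$ be any generators of $\mathcal S$ that give an isomorphism $\prod_{i=1}^t\mathbb Z/n_i\cong\mathcal S$, $a\mapsto K^a=K_1^{a_1}\cdots K_t^{a_t}$ (with $n_i\ge 1$), let $q_i\in\mathbb C$ be a primitive $n_i$-th root of unity for each $i$, and let $\beta:\mathbb C\mathcal S\times\mathbb C\mathcal S\to\mathbb C$ be the bilinear form with $\beta(K^a,K^b)=q^{ab}=\prod_{i}q_i^{a_ib_i}$. Put $B_c=\{x\in\mathcal S\mid\beta(x,c)\neq 0\}$. Then the nilradical of $R$ is the image under $\Phi$ of the orthogonal space of $\mathbb C B_c$, namely of $\{v\in\mathbb C\mathcal S\mid\beta(x,v)=0\text{ for all }x\in B_c\}$. -/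

import Mathlib

open scoped TensorProduct
universe u
namespace HopfK0

section Modules

variable (k Λ : Type u) [Field k] [Ring Λ]

/-- A finitely generated left `Λ`-module over the `k`-algebra `Λ`, with its underlying
`k`-vector space. -/
structure FGMod [Algebra k Λ] where
  carrier : Type u
  [addCommGroup : AddCommGroup carrier]
  [moduleField : Module k carrier]
  [module : Module Λ carrier]
  [isScalarTower : IsScalarTower k Λ carrier]
  [finite : Module.Finite Λ carrier]

attribute [instance] FGMod.addCommGroup FGMod.moduleField FGMod.module FGMod.isScalarTower
  FGMod.finite

/-- Isomorphism of `Λ`-modules. -/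
instance FGMod.setoid [Algebra k Λ] : Setoid (FGMod k Λ) where
  r M N := Nonempty (M.carrier ≃ₗ[Λ] N.carrier)
  iseqv := ⟨fun M => ⟨.refl Λ M.carrier⟩, fun ⟨e⟩ => ⟨e.symm⟩, fun ⟨e⟩ ⟨f⟩ => ⟨e.trans f⟩⟩

/-- Isomorphism classes of finitely generated `Λ`-modules. -/
def IsoClass [Algebra k Λ] : Type (u + 1) := Quotient (FGMod.setoid k Λ)

variable {k Λ}

/-- The isomorphism class of a module. -/
def FGMod.cls [Algebra k Λ] (M : FGMod k Λ) : IsoClass k Λ := Quotient.mk _ M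

theorem FGMod.finite_field [Algebra k Λ] [Module.Finite k Λ] (M : FGMod k Λ) :
    Module.Finite k M.carrier := Module.Finite.trans Λ M.carrier

/-- The `Λ`-module given by a representation of `Λ` on a finite dimensional vector space. -/
def FGMod.ofAction [Algebra k Λ] (V : Type u) [AddCommGroup V] [Module k V] [Module.Finite k V]
    (ρ : Λ →ₐ[k] Module.End k V) : FGMod k Λ :=
  letI : Module Λ V := Module.compHom V ρ.toRingHom
  haveI : IsScalarTower k Λ V := ⟨fun a x m => by
    change ρ (a • x) m = a • ρ x m
    rw [map_smul, LinearMap.smul_apply]⟩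
  { carrier := V
    finite := Module.Finite.of_restrictScalars_finite k Λ V }

/-- A `k`-linear isomorphism that commutes with the actions gives equal classes. -/
theorem FGMod.cls_eq [Algebra k Λ] (M N : FGMod k Λ) (e : M.carrier ≃ₗ[k] N.carrier)
    (h : ∀ (a : Λ) (m : M.carrier), e (a • m) = a • e m) : M.cls = N.cls :=
  Quotient.sound ⟨{ e with map_smul' := h }⟩

section Hopf

variable [HopfAlgebra k Λ]

/-- The action of `Λ` on `M ⊗ N` through the comultiplication:
`a • (m ⊗ n) = ∑ a₍₁₎ m ⊗ a₍₂₎ n`. -/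
noncomputable def FGMod.tensorAction (M N : FGMod k Λ) :
    Λ →ₐ[k] Module.End k (M.carrier ⊗[k] N.carrier) :=
  (Module.endTensorEndAlgHom (R := k) (S := k) (A := k)).comp
    ((Algebra.TensorProduct.map (Algebra.lsmul k k M.carrier) (Algebra.lsmul k k N.carrier)).comp
      (Bialgebra.comulAlgHom k Λ))

theorem FGMod.tensorAction_tmul (M N : FGMod k Λ) (a : Λ) (m : M.carrier) (n : N.carrier) :
    M.tensorAction N a (m ⊗ₜ n) =
      TensorProduct.map ((LinearMap.toSpanSingleton Λ _ m).restrictScalars k)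
        ((LinearMap.toSpanSingleton Λ _ n).restrictScalars k) (Coalgebra.comul (R := k) a) := by
  simp only [tensorAction, AlgHom.comp_apply, Bialgebra.comulAlgHom_apply]
  induction Coalgebra.comul (R := k) a using TensorProduct.induction_on with
  | zero => simp
  | tmul x y =>
    simp [Module.endTensorEndAlgHom_apply]
  | add x y hx hy => simp only [map_add, LinearMap.add_apply, hx, hy]

variable [Module.Finite k Λ]

/-- The tensor product `M ⊗ N` over `k` with the diagonal action of `Λ`. -/
noncomputable def FGMod.tensor (M N : FGMod k Λ) : FGMod k Λ :=
  haveI := M.finite_field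
  haveI := N.finite_field
  FGMod.ofAction (M.carrier ⊗[k] N.carrier) (M.tensorAction N)

/-- The trivial module `k_ε`. -/
noncomputable def FGMod.trivial (k Λ : Type u) [Field k] [Ring Λ] [HopfAlgebra k Λ] : FGMod k Λ :=
  FGMod.ofAction k ((Algebra.lsmul k k k).comp (Bialgebra.counitAlgHom k Λ))

/-- The action of `Λ` on `M* = Hom_k(M, k)` through the antipode: `(a • f)(m) = f(S(a) m)`. -/
noncomputable def FGMod.dualAction (M : FGMod k Λ) :
    Λ →ₐ[k] Module.End k (Module.Dual k M.carrier) :=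
  AlgHom.ofLinearMap
    (Module.Dual.transpose ∘ₗ (Algebra.lsmul k k M.carrier).toLinearMap ∘ₗ
      HopfAlgebra.antipode k (A := Λ))
    (by ext f m; simp [Module.Dual.transpose_apply])
    (fun a b => by
      ext f m
      simp [HopfAlgebra.antipode_mul_antidistrib, Module.Dual.transpose_apply])

/-- The dual module. -/
noncomputable def FGMod.dual (M : FGMod k Λ) : FGMod k Λ :=
  haveI := M.finite_field
  FGMod.ofAction (Module.Dual k M.carrier) M.dualAction

theorem FGMod.tensor_assoc (M N P : FGMod k Λ) :
    ((M.tensor N).tensor P).cls = (M.tensor (N.tensor P)).cls := by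
  refine FGMod.cls_eq _ _ (TensorProduct.assoc k M.carrier N.carrier P.carrier) fun a x => ?_
  change (TensorProduct.assoc k M.carrier N.carrier P.carrier)
      ((M.tensor N).tensorAction P a x) =
    M.tensorAction (N.tensor P) a (TensorProduct.assoc k M.carrier N.carrier P.carrier x)
  refine LinearMap.congr_fun (f := (TensorProduct.assoc k M.carrier N.carrier P.carrier).toLinearMap
    ∘ₗ ((M.tensor N).tensorAction P a : (M.carrier ⊗[k] N.carrier) ⊗[k] P.carrier →ₗ[k]
      (M.carrier ⊗[k] N.carrier) ⊗[k] P.carrier))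
    (g := (M.tensorAction (N.tensor P) a : M.carrier ⊗[k] (N.carrier ⊗[k] P.carrier) →ₗ[k]
      M.carrier ⊗[k] (N.carrier ⊗[k] P.carrier)) ∘ₗ
      (TensorProduct.assoc k M.carrier N.carrier P.carrier).toLinearMap) ?_ x
  refine TensorProduct.ext_threefold fun m n p => ?_
  let f := (LinearMap.toSpanSingleton Λ _ m).restrictScalars k
  let g := (LinearMap.toSpanSingleton Λ _ n).restrictScalars k
  let h := (LinearMap.toSpanSingleton Λ _ p).restrictScalars k
  have h1 : (LinearMap.toSpanSingleton Λ (M.tensor N).carrier (m ⊗ₜ[k] n)).restrictScalars k =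
      TensorProduct.map f g ∘ₗ Coalgebra.comul (R := k) :=
    LinearMap.ext fun b => FGMod.tensorAction_tmul M N b m n
  have h2 : (LinearMap.toSpanSingleton Λ (N.tensor P).carrier (n ⊗ₜ[k] p)).restrictScalars k =
      TensorProduct.map g h ∘ₗ Coalgebra.comul (R := k) :=
    LinearMap.ext fun b => FGMod.tensorAction_tmul N P b n p
  change (TensorProduct.assoc k M.carrier N.carrier P.carrier)
      ((M.tensor N).tensorAction P a ((m ⊗ₜ[k] n) ⊗ₜ[k] p)) =
    M.tensorAction (N.tensor P) a (m ⊗ₜ[k] (n ⊗ₜ[k] p))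
  have e1 : (M.tensor N).tensorAction P a ((m ⊗ₜ[k] n) ⊗ₜ[k] p) =
      TensorProduct.map (TensorProduct.map f g) h
        ((Coalgebra.comul (R := k)).rTensor Λ (Coalgebra.comul (R := k) a)) := by
    refine (FGMod.tensorAction_tmul (M.tensor N) P a (m ⊗ₜ[k] n) p).trans ?_
    rw [h1]
    exact (LinearMap.congr_fun (LinearMap.map_comp_rTensor _ _ _ _) _).symm
  have e2 : M.tensorAction (N.tensor P) a (m ⊗ₜ[k] (n ⊗ₜ[k] p)) =
      TensorProduct.map f (TensorProduct.map g h)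
        ((Coalgebra.comul (R := k)).lTensor Λ (Coalgebra.comul (R := k) a)) := by
    refine (FGMod.tensorAction_tmul M (N.tensor P) a m (n ⊗ₜ[k] p)).trans ?_
    rw [h2]
    exact (LinearMap.congr_fun (LinearMap.map_comp_lTensor _ _ _ _) _).symm
  refine (congrArg _ e1).trans (Eq.trans ?_ e2.symm)
  rw [← Coalgebra.coassoc_apply]
  exact LinearMap.congr_fun (TensorProduct.map_map_comp_assoc_eq f g h).symm _

theorem FGMod.trivial_tensor (M : FGMod k Λ) : ((FGMod.trivial k Λ).tensor M).cls = M.cls := by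
  refine FGMod.cls_eq _ _ (TensorProduct.lid k M.carrier) fun a x => ?_
  refine LinearMap.congr_fun (f := (TensorProduct.lid k M.carrier).toLinearMap
    ∘ₗ ((FGMod.trivial k Λ).tensorAction M a : k ⊗[k] M.carrier →ₗ[k] k ⊗[k] M.carrier))
    (g := (Algebra.lsmul k k M.carrier a) ∘ₗ (TensorProduct.lid k M.carrier).toLinearMap) ?_ x
  refine TensorProduct.ext' fun c m => ?_
  let f := (LinearMap.toSpanSingleton Λ _ m).restrictScalars k
  have h1 : (LinearMap.toSpanSingleton Λ (FGMod.trivial k Λ).carrier c).restrictScalars k =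
      (LinearMap.mul k k).flip c ∘ₗ Coalgebra.counit (R := k) (A := Λ) := LinearMap.ext fun b => rfl
  have e1 : (FGMod.trivial k Λ).tensorAction M a (c ⊗ₜ[k] m) =
      TensorProduct.map ((LinearMap.mul k k).flip c) f
        ((Coalgebra.counit (R := k)).rTensor Λ (Coalgebra.comul (R := k) a)) := by
    refine (FGMod.tensorAction_tmul _ M a c m).trans ?_
    rw [h1]
    exact (LinearMap.congr_fun (LinearMap.map_comp_rTensor _ _ _ _) _).symm
  rw [Coalgebra.rTensor_counit_comul] at e1
  refine (congrArg (TensorProduct.lid k M.carrier) e1).trans ?_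
  change ((1 : k) * (show k from c)) • (a • m) = a • ((show k from c) • m)
  rw [one_mul, smul_comm]

theorem FGMod.tensor_trivial (M : FGMod k Λ) : (M.tensor (FGMod.trivial k Λ)).cls = M.cls := by
  refine FGMod.cls_eq _ _ (TensorProduct.rid k M.carrier) fun a x => ?_
  refine LinearMap.congr_fun (f := (TensorProduct.rid k M.carrier).toLinearMap
    ∘ₗ (M.tensorAction (FGMod.trivial k Λ) a : M.carrier ⊗[k] k →ₗ[k] M.carrier ⊗[k] k))
    (g := (Algebra.lsmul k k M.carrier a) ∘ₗ (TensorProduct.rid k M.carrier).toLinearMap) ?_ x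
  refine TensorProduct.ext' fun m c => ?_
  let f := (LinearMap.toSpanSingleton Λ _ m).restrictScalars k
  have h1 : (LinearMap.toSpanSingleton Λ (FGMod.trivial k Λ).carrier c).restrictScalars k =
      (LinearMap.mul k k).flip c ∘ₗ Coalgebra.counit (R := k) (A := Λ) := LinearMap.ext fun b => rfl
  have e1 : M.tensorAction (FGMod.trivial k Λ) a (m ⊗ₜ[k] c) =
      TensorProduct.map f ((LinearMap.mul k k).flip c)
        ((Coalgebra.counit (R := k)).lTensor Λ (Coalgebra.comul (R := k) a)) := by
    refine (FGMod.tensorAction_tmul M _ a m c).trans ?_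
    rw [h1]
    exact (LinearMap.congr_fun (LinearMap.map_comp_lTensor _ _ _ _) _).symm
  rw [Coalgebra.lTensor_counit_comul] at e1
  refine (congrArg (TensorProduct.rid k M.carrier) e1).trans ?_
  change ((1 : k) * (show k from c)) • (a • m) = a • ((show k from c) • m)
  rw [one_mul, smul_comm]

theorem FGMod.tensor_congr {M M' N N' : FGMod k Λ} (e : M.carrier ≃ₗ[Λ] M'.carrier)
    (f : N.carrier ≃ₗ[Λ] N'.carrier) : (M.tensor N).cls = (M'.tensor N').cls := by
  let e' := e.restrictScalars k
  let f' := f.restrictScalars k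
  refine FGMod.cls_eq _ _ (TensorProduct.congr e' f') fun a x => ?_
  refine LinearMap.congr_fun (f := (TensorProduct.congr e' f').toLinearMap
    ∘ₗ (M.tensorAction N a))
    (g := (M'.tensorAction N' a) ∘ₗ (TensorProduct.congr e' f').toLinearMap) ?_ x
  refine TensorProduct.ext' fun m n => ?_
  simp only [LinearMap.comp_apply, FGMod.tensorAction_tmul, LinearEquiv.coe_coe,
    TensorProduct.congr_tmul]
  generalize Coalgebra.comul (R := k) a = z
  induction z using TensorProduct.induction_on with
  | zero => simp
  | tmul x y => simp [e', f']
  | add x y hx hy => simp only [map_add, hx, hy]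

/-- Isomorphism classes form a monoid under the tensor product, with unit `k_ε`. -/
noncomputable instance IsoClass.monoid : Monoid (IsoClass k Λ) where
  mul := Quotient.map₂ FGMod.tensor fun _ _ ⟨e⟩ _ _ ⟨f⟩ =>
    Quotient.exact (FGMod.tensor_congr e f)
  one := (FGMod.trivial k Λ).cls
  mul_assoc := by
    rintro ⟨M⟩ ⟨N⟩ ⟨P⟩
    exact FGMod.tensor_assoc M N P
  one_mul := by
    rintro ⟨M⟩
    exact FGMod.trivial_tensor M
  mul_one := by
    rintro ⟨M⟩
    exact FGMod.tensor_trivial M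


theorem IsoClass.cls_mul (M N : FGMod k Λ) : M.cls * N.cls = (M.tensor N).cls := rfl

end Hopf

/-! ### Basic and split algebras, the structure group -/

/-- A split algebra: the endomorphism algebra of every simple module is the ground field. -/
def IsSplit (k Λ : Type u) [Field k] [Ring Λ] [Algebra k Λ] : Prop :=
  ∀ M : FGMod k Λ, IsSimpleModule Λ M.carrier → Nonempty (Module.End Λ M.carrier ≃ₐ[k] k)

/-- A basic algebra: every simple module has multiplicity one in the maximal semisimple
quotient `Λ / rad Λ`, that is, its isotypic component there is a single copy of it. -/
def IsBasic (k Λ : Type u) [Field k] [Ring Λ] [Algebra k Λ] : Prop :=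
  ∀ M : FGMod k Λ, IsSimpleModule Λ M.carrier →
    Nonempty (isotypicComponent Λ (Λ ⧸ Ring.jacobson Λ) M.carrier ≃ₗ[Λ] M.carrier)

/-- Basic and split algebras. -/
class IsBasicSplit (k Λ : Type u) [Field k] [Ring Λ] [Algebra k Λ] : Prop where
  split : IsSplit k Λ
  basic : IsBasic k Λ

theorem FGMod.isSimple_of_finrank_eq_one [Algebra k Λ] (M : FGMod k Λ)
    (h : Module.finrank k M.carrier = 1) : IsSimpleModule Λ M.carrier := by
  have hs : IsSimpleModule k M.carrier := isSimpleModule_iff_finrank_eq_one.mpr h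
  have hn : Nontrivial M.carrier := IsSimpleModule.nontrivial k M.carrier
  refine { toNontrivial := inferInstance, eq_bot_or_eq_top := fun N => ?_ }
  rcases eq_bot_or_eq_top (N.restrictScalars k) with h0 | h1
  · left
    exact (Submodule.restrictScalars_eq_bot_iff k Λ M.carrier).mp h0
  · right
    exact (Submodule.restrictScalars_eq_top_iff k Λ M.carrier).mp h1

theorem isSemisimpleModule_quotient_jacobson (k Λ : Type u) [Field k] [Ring Λ] [Algebra k Λ]
    [Module.Finite k Λ] : IsSemisimpleModule Λ (Λ ⧸ Ring.jacobson Λ) := by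
  have : IsArtinianRing Λ := IsArtinianRing.of_finite k Λ
  refine (IsArtinian.isSemisimpleModule_iff_jacobson Λ _).mpr ?_
  exact Module.jacobson_quotient_jacobson Λ Λ

/-- Simple modules over a basic and split algebra are one-dimensional. -/
theorem FGMod.finrank_eq_one [Algebra k Λ] [Module.Finite k Λ] [IsBasicSplit k Λ]
    (M : FGMod k Λ) (hM : IsSimpleModule Λ M.carrier) : Module.finrank k M.carrier = 1 := by
  have := isSemisimpleModule_quotient_jacobson k Λ
  obtain ⟨sp⟩ := IsBasicSplit.split (k := k) (Λ := Λ) M hM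
  obtain ⟨ba⟩ := IsBasicSplit.basic (k := k) (Λ := Λ) M hM
  set C := isotypicComponent Λ (Λ ⧸ Ring.jacobson Λ) M.carrier with hC
  have : IsSimpleModule Λ C := IsSimpleModule.congr ba
  have : Nontrivial M.carrier := IsSimpleModule.nontrivial Λ M.carrier
  have key : ∀ f : (Λ ⧸ Ring.jacobson Λ) →ₗ[Λ] M.carrier, f ≠ 0 → f ∘ₗ C.subtype ≠ 0 := by
    intro f hf h0
    have hs : Function.Surjective f := LinearMap.surjective_of_ne_zero hf
    obtain ⟨D, hD⟩ := exists_isCompl (LinearMap.ker f)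
    have eD : D ≃ₗ[Λ] M.carrier :=
      ((LinearMap.ker f).quotientEquivOfIsCompl D hD).symm.trans (f.quotKerEquivOfSurjective hs)
    have hDC : D ≤ C := le_sSup ⟨eD⟩
    have hDk : D ≤ LinearMap.ker f := fun z hz => LinearMap.congr_fun h0 ⟨z, hDC hz⟩
    have hb : D = ⊥ := by
      rw [← le_bot_iff, ← hD.inf_eq_bot]
      exact le_inf hDk le_rfl
    apply hf
    rw [← LinearMap.ker_eq_top, ← hD.sup_eq_top, hb, sup_bot_eq]
  have hscal : ∀ φ : Module.End Λ M.carrier, ∃ a : k, φ = algebraMap k _ a := fun φ =>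
    ⟨sp φ, by rw [← sp.symm.commutes]; simp⟩
  obtain ⟨x, hx⟩ := exists_ne (0 : M.carrier)
  have ann : ∀ y : M.carrier, Ring.jacobson Λ ≤ LinearMap.ker (LinearMap.toSpanSingleton Λ _ y) :=
    fun y => by
      intro a ha
      exact Module.mem_annihilator.mp (IsSemisimpleModule.jacobson_le_annihilator Λ M.carrier ha) y
  let F : M.carrier → ((Λ ⧸ Ring.jacobson Λ) →ₗ[Λ] M.carrier) := fun y =>
    (Ring.jacobson Λ).liftQ (LinearMap.toSpanSingleton Λ _ y) (ann y)
  have F1 : ∀ y, F y (Submodule.Quotient.mk 1) = y := fun y =>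
    one_smul Λ y
  have Fx : F x ≠ 0 := fun h => hx (by rw [← F1 x, h]; rfl)
  have bij : Function.Bijective (F x ∘ₗ C.subtype) := LinearMap.bijective_of_ne_zero (key _ Fx)
  let e := LinearEquiv.ofBijective _ bij
  refine _root_.finrank_eq_one x hx fun y => ?_
  obtain ⟨a, ha⟩ := hscal ((F y ∘ₗ C.subtype) ∘ₗ e.symm.toLinearMap)
  refine ⟨a, ?_⟩
  by_contra hne
  have hd : F y - algebraMap k (Module.End Λ M.carrier) a ∘ₗ F x ≠ 0 := fun h0 => by
    apply hne
    have := LinearMap.congr_fun h0 (Submodule.Quotient.mk 1)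
    simp only [LinearMap.sub_apply, LinearMap.comp_apply, F1, LinearMap.zero_apply] at this
    exact (sub_eq_zero.mp this).symm
  refine key _ hd (LinearMap.ext fun z => ?_)
  have := LinearMap.congr_fun ha (e z)
  simp only [LinearMap.comp_apply, LinearEquiv.coe_coe, LinearEquiv.symm_apply_apply] at this
  simp only [LinearMap.comp_apply, LinearMap.sub_apply, LinearMap.zero_apply]
  exact sub_eq_zero.mpr this

section StructureGroup

variable [HopfAlgebra k Λ]

variable (k Λ) in
/-- The structure group: isomorphism classes of simple modules. -/
def StructureGroup : Type (u + 1) :=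
  {x : IsoClass k Λ // ∃ M : FGMod k Λ, IsSimpleModule Λ M.carrier ∧ M.cls = x}

/-- The element of the structure group given by a simple module. -/
def StructureGroup.mk (M : FGMod k Λ) (h : IsSimpleModule Λ M.carrier) : StructureGroup k Λ :=
  ⟨M.cls, M, h, rfl⟩

/-- A simple module in the given class. -/
noncomputable def StructureGroup.rep (s : StructureGroup k Λ) : FGMod k Λ := s.2.choose

theorem StructureGroup.rep_spec (s : StructureGroup k Λ) :
    IsSimpleModule Λ s.rep.carrier ∧ s.rep.cls = s.1 := s.2.choose_spec

theorem FGMod.trivial_isSimple : IsSimpleModule Λ (FGMod.trivial k Λ).carrier :=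
  FGMod.isSimple_of_finrank_eq_one _ (Module.finrank_self k)

variable [Module.Finite k Λ]

theorem FGMod.dual_tensor (M : FGMod k Λ) (h : Module.finrank k M.carrier = 1) :
    (M.dual.tensor M).cls = (FGMod.trivial k Λ).cls := by
  have hn : Nontrivial M.carrier := Module.nontrivial_of_finrank_pos (R := k) (by omega)
  obtain ⟨x, hx⟩ := exists_ne (0 : M.carrier)
  have hspan : ∀ v : M.carrier, ∃ c : k, c • x = v := (finrank_eq_one_iff_of_nonzero' x hx).mp h
  have hsurj : Function.Surjective (contractLeft k M.carrier) := by
    obtain ⟨f, hf⟩ := Module.Projective.exists_dual_ne_zero k hx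
    exact fun c => ⟨((c / f x) • f) ⊗ₜ x, by simp [hf]⟩
  have hform : ∀ z : Module.Dual k M.carrier ⊗[k] M.carrier,
      ∃ f : Module.Dual k M.carrier, z = f ⊗ₜ x := by
    intro z
    induction z using TensorProduct.induction_on with
    | zero => exact ⟨0, (TensorProduct.zero_tmul _ _).symm⟩
    | tmul f v =>
      obtain ⟨c, rfl⟩ := hspan v
      exact ⟨c • f, TensorProduct.smul_tmul c f x |>.symm⟩
    | add y z hy hz =>
      obtain ⟨f, rfl⟩ := hy
      obtain ⟨g, rfl⟩ := hz
      exact ⟨f + g, (TensorProduct.add_tmul f g x).symm⟩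
  have hinj : Function.Injective (contractLeft k M.carrier) := by
    intro y z hyz
    obtain ⟨f, rfl⟩ := hform y
    obtain ⟨g, rfl⟩ := hform z
    rw [contractLeft_apply, contractLeft_apply] at hyz
    have hfg : f = g := LinearMap.ext fun v => by
      obtain ⟨c, rfl⟩ := hspan v
      rw [map_smul, map_smul, hyz]
    rw [hfg]
  let e := LinearEquiv.ofBijective (contractLeft k M.carrier) ⟨hinj, hsurj⟩
  refine FGMod.cls_eq _ _ e fun a x => ?_
  refine LinearMap.congr_fun (f := contractLeft k M.carrier ∘ₗ (M.dual.tensorAction M a :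
      Module.Dual k M.carrier ⊗[k] M.carrier →ₗ[k] Module.Dual k M.carrier ⊗[k] M.carrier))
    (g := Coalgebra.counit (R := k) a • contractLeft k M.carrier) ?_ x
  refine TensorProduct.ext' fun (f : Module.Dual k M.carrier) m => ?_
  let u : Λ →ₗ[k] Module.Dual k M.carrier :=
    (LinearMap.toSpanSingleton Λ M.dual.carrier f).restrictScalars k
  let v : Λ →ₗ[k] M.carrier := (LinearMap.toSpanSingleton Λ _ m).restrictScalars k
  have e1 : ∀ z : Λ ⊗[k] Λ, contractLeft k M.carrier (TensorProduct.map u v z) =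
      f (LinearMap.mul' k Λ ((HopfAlgebra.antipode k).rTensor Λ z) • m) := by
    intro z
    induction z using TensorProduct.induction_on with
    | zero => simp
    | tmul x y =>
      simp only [TensorProduct.map_tmul, LinearMap.rTensor_tmul, LinearMap.mul'_apply, mul_smul,
        contractLeft_apply]
      rfl
    | add x y hx hy => simp only [map_add, hx, hy, add_smul]
  refine (congrArg (contractLeft k M.carrier) (FGMod.tensorAction_tmul M.dual M a f m)).trans ?_
  refine (e1 _).trans ?_
  rw [HopfAlgebra.mul_antipode_rTensor_comul_apply, algebraMap_smul, map_smul]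
  rfl

theorem FGMod.tensor_isSimple [IsBasicSplit k Λ] (M N : FGMod k Λ)
    (hM : IsSimpleModule Λ M.carrier) (hN : IsSimpleModule Λ N.carrier) :
    IsSimpleModule Λ (M.tensor N).carrier :=
  FGMod.isSimple_of_finrank_eq_one _ <|
    (Module.finrank_tensorProduct (R := k) (S := k) (M := M.carrier) (M' := N.carrier)).trans
      (by rw [M.finrank_eq_one hM, N.finrank_eq_one hN])

theorem FGMod.dual_isSimple [IsBasicSplit k Λ] (M : FGMod k Λ)
    (hM : IsSimpleModule Λ M.carrier) : IsSimpleModule Λ M.dual.carrier :=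
  FGMod.isSimple_of_finrank_eq_one _ <|
    (Subspace.dual_finrank_eq (K := k) (V := M.carrier)).trans (M.finrank_eq_one hM)

/-- The group law is the tensor product, the unit is the class of `k_ε`; the inverse of the class
of `S` is the class of the dual module `S*`. -/
noncomputable instance StructureGroup.group [IsBasicSplit k Λ] : Group (StructureGroup k Λ) :=
  letI : Mul (StructureGroup k Λ) := ⟨fun x y => ⟨x.1 * y.1, by
    obtain ⟨_, M, hM, rfl⟩ := x
    obtain ⟨_, N, hN, rfl⟩ := y
    exact ⟨M.tensor N, M.tensor_isSimple N hM hN, rfl⟩⟩⟩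
  letI : One (StructureGroup k Λ) := ⟨StructureGroup.mk _ FGMod.trivial_isSimple⟩
  letI : Inv (StructureGroup k Λ) := ⟨fun x =>
    StructureGroup.mk x.rep.dual (x.rep.dual_isSimple x.rep_spec.1)⟩
  Group.ofLeftAxioms (fun x y z => Subtype.ext (mul_assoc x.1 y.1 z.1))
    (fun x => Subtype.ext (one_mul x.1))
    (fun x => Subtype.ext <|
      (congrArg (x.rep.dual.cls * ·) x.rep_spec.2.symm).trans
        (x.rep.dual_tensor (x.rep.finrank_eq_one x.rep_spec.1)))

end StructureGroup

/-! ### The Grothendieck ring and the projective class ring -/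

section K0

variable [HopfAlgebra k Λ] [Module.Finite k Λ]

variable (k Λ) in
/-- The relations `[X₂] = [X₁] + [X₃]` given by the split exact sequences
`0 → X₁ → X₂ → X₃ → 0`. -/
inductive SplitRel : MonoidAlgebra ℤ (IsoClass k Λ) → MonoidAlgebra ℤ (IsoClass k Λ) → Prop
  | mk (X₁ X₂ X₃ : FGMod k Λ) (i : X₁.carrier →ₗ[Λ] X₂.carrier) (p : X₂.carrier →ₗ[Λ] X₃.carrier)
      (s : X₃.carrier →ₗ[Λ] X₂.carrier) (hi : Function.Injective i) (hip : Function.Exact i p)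
      (hp : Function.Surjective p) (hs : p ∘ₗ s = LinearMap.id) :
      SplitRel (MonoidAlgebra.of ℤ _ X₂.cls)
        (MonoidAlgebra.of ℤ _ X₁.cls + MonoidAlgebra.of ℤ _ X₃.cls)

variable (k Λ) in
/-- The Grothendieck ring `K₀(Λ)`: the free abelian group on the isomorphism classes of finitely
generated modules, with the product given by the tensor product, modulo the relations given by
split exact sequences. (The subgroup generated by these relations is a two-sided ideal, so it does
not matter that the quotient is taken by the ideal that they generate.) -/
def K0 : Type (u + 1) := RingQuot (SplitRel k Λ)

noncomputable instance K0.ring : Ring (K0 k Λ) := inferInstanceAs (Ring (RingQuot (SplitRel k Λ)))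

/-- The class `[M]` in `K₀(Λ)`. -/
noncomputable def FGMod.k0 (M : FGMod k Λ) : K0 k Λ :=
  RingQuot.mkRingHom (SplitRel k Λ) (MonoidAlgebra.of ℤ _ M.cls)

variable (k Λ) in
/-- The subring `K₀ᵖ(Λ)` generated by the projective and the semisimple modules. -/
noncomputable def K0p : Subring (K0 k Λ) :=
  Subring.closure {x | ∃ M : FGMod k Λ,
    (Module.Projective Λ M.carrier ∨ IsSemisimpleModule Λ M.carrier) ∧ x = M.k0}

variable (k Λ) in
/-- The complexified projective class ring `ℂ ⊗ K₀ᵖ(Λ)`. -/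
abbrev CK0p : Type (u + 1) := ℂ ⊗[ℤ] K0p k Λ

/-- The element `1 ⊗ [P]` of `ℂ ⊗ K₀ᵖ(Λ)` for a projective module `P`. -/
noncomputable def projClass (P : FGMod k Λ) (h : Module.Projective Λ P.carrier) : CK0p k Λ :=
  (1 : ℂ) ⊗ₜ[ℤ] (⟨P.k0, Subring.subset_closure ⟨P, Or.inl h, rfl⟩⟩ : K0p k Λ)

variable (k Λ) in
/-- The subspace of `ℂ ⊗ K₀ᵖ(Λ)` spanned by the projective modules. -/
noncomputable def projIdeal : Submodule ℂ (CK0p k Λ) :=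
  Submodule.span ℂ {x | ∃ (P : FGMod k Λ) (h : Module.Projective Λ P.carrier), x = projClass P h}

end K0

/-! ### Projective covers, composition series, the canonical element -/

section Cover

/-- `ψ : P → M` is a projective cover: `P` is projective and `ψ` is an essential surjection. -/
structure IsProjectiveCover [Algebra k Λ] {P M : FGMod k Λ} (ψ : P.carrier →ₗ[Λ] M.carrier) :
    Prop where
  projective : Module.Projective Λ P.carrier
  surjective : Function.Surjective ψ
  essential : ∀ X : Submodule Λ P.carrier, X ≠ ⊤ → ¬ Function.Surjective (ψ.domRestrict X)

theorem exists_projectiveCover [Algebra k Λ] [Module.Finite k Λ] (M : FGMod k Λ) :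
    ∃ (P : FGMod k Λ) (ψ : P.carrier →ₗ[Λ] M.carrier), IsProjectiveCover ψ := by
  classical
  let A : ℕ → Prop := fun d => ∃ (P : FGMod k Λ) (ψ : P.carrier →ₗ[Λ] M.carrier),
    Module.Projective Λ P.carrier ∧ Function.Surjective ψ ∧ Module.finrank k P.carrier = d
  have hA : ∃ d, A d := by
    obtain ⟨n, f, hf⟩ := Module.Finite.exists_fin' Λ M.carrier
    exact ⟨_, { carrier := Fin n → Λ }, f, inferInstanceAs (Module.Projective Λ (Fin n → Λ)), hf, rfl⟩
  obtain ⟨P, ψ, hP, hψ, hd⟩ := Nat.find_spec hA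
  refine ⟨P, ψ, hP, hψ, fun X hX hXs => ?_⟩
  have := P.finite_field
  have hn : IsNoetherian Λ P.carrier := isNoetherian_of_tower k inferInstance
  have ha : IsArtinian Λ P.carrier := isArtinian_of_tower k inferInstance
  obtain ⟨h, hh⟩ := Module.projective_lifting_property (ψ.domRestrict X) ψ hXs
  let g : Module.End Λ P.carrier := X.subtype ∘ₗ h
  have hg : ∀ x, ψ (g x) = ψ x := fun x => LinearMap.congr_fun hh x
  have hgn : ∀ (n : ℕ) x, ψ ((g ^ n) x) = ψ x := by
    intro n
    induction n with
    | zero => intro x; rfl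
    | succ n ih => intro x; rw [pow_succ', Module.End.mul_apply, hg, ih]
  obtain ⟨n, hn1, hc⟩ :=
    ((Filter.eventually_ge_atTop 1).and g.eventually_isCompl_ker_pow_range_pow).exists
  let Y := LinearMap.range (g ^ n)
  have hYX : Y ≤ X := by
    rintro _ ⟨x, rfl⟩
    obtain ⟨m, rfl⟩ := Nat.exists_eq_add_of_le' hn1
    rw [pow_succ', Module.End.mul_apply]
    exact (h _).2
  have hYp : Module.Projective Λ Y := by
    refine Module.Projective.of_split Y.subtype (Submodule.projectionOnto Y _ hc.symm) ?_
    exact LinearMap.ext fun y => Submodule.projectionOnto_apply_left hc.symm y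
  have hYs : Function.Surjective (ψ.domRestrict Y) := fun m => by
    obtain ⟨x, rfl⟩ := hψ m
    exact ⟨⟨(g ^ n) x, x, rfl⟩, hgn n x⟩
  have hlt : Module.finrank k Y < Module.finrank k P.carrier := by
    refine Submodule.finrank_lt (s := Y.restrictScalars k) fun ht => hX ?_
    exact top_le_iff.mp (((Submodule.restrictScalars_eq_top_iff k Λ P.carrier).mp ht).ge.trans hYX)
  rw [hd] at hlt
  exact Nat.find_min hA hlt ⟨{ carrier := Y }, ψ.domRestrict Y, hYp, hYs, rfl⟩

/-- The projective cover of a module; it is unique up to isomorphism. -/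
noncomputable def projCover [Algebra k Λ] [Module.Finite k Λ] (M : FGMod k Λ) : FGMod k Λ :=
  (exists_projectiveCover M).choose

theorem projCover_spec [Algebra k Λ] [Module.Finite k Λ] (M : FGMod k Λ) :
    ∃ ψ : (projCover M).carrier →ₗ[Λ] M.carrier, IsProjectiveCover ψ :=
  (exists_projectiveCover M).choose_spec

theorem projCover_projective [Algebra k Λ] [Module.Finite k Λ] (M : FGMod k Λ) :
    Module.Projective Λ (projCover M).carrier :=
  (projCover_spec M).choose_spec.projective

/-- The quotient `N / N'` of submodules `N' ≤ N` of a module. -/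
def FGMod.subquotient [Algebra k Λ] [Module.Finite k Λ] (M : FGMod k Λ)
    (N' N : Submodule Λ M.carrier) : FGMod k Λ :=
  have := M.finite_field
  have : IsNoetherian Λ M.carrier := isNoetherian_of_tower k inferInstance
  { carrier := N ⧸ N'.submoduleOf N }

variable [HopfAlgebra k Λ] [Module.Finite k Λ]

/-- The sum in `ℤ𝒮` of the classes of the quotients of a composition series. -/
noncomputable def compositionSum (M : FGMod k Λ) (σ : CompositionSeries (Submodule Λ M.carrier)) :
    MonoidAlgebra ℤ (StructureGroup k Λ) :=
  ∑ i : Fin σ.length, MonoidAlgebra.single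
    (StructureGroup.mk (M.subquotient (σ i.castSucc) (σ i.succ))
      ((covBy_iff_quot_is_simple (σ.step i).le).mp (σ.step i))) 1

theorem exists_compositionSeries (M : FGMod k Λ) :
    ∃ σ : CompositionSeries (Submodule Λ M.carrier), σ.head = ⊥ ∧ σ.last = ⊤ := by
  have := M.finite_field
  have : IsNoetherian Λ M.carrier := isNoetherian_of_tower k inferInstance
  have : IsArtinian Λ M.carrier := isArtinian_of_tower k inferInstance
  exact exists_compositionSeries_of_isNoetherian_isArtinian Λ M.carrier

/-- The sum `M̄` in `ℤ𝒮` of the quotients of a composition series of `M`; it does not depend on the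
series. -/
noncomputable def dimVector (M : FGMod k Λ) : MonoidAlgebra ℤ (StructureGroup k Λ) :=
  compositionSum M (exists_compositionSeries M).choose

variable (k Λ) in
/-- The canonical element `c` of `ℤ𝒮`, given by a composition series of the projective cover of
the trivial module. -/
noncomputable def canonicalElement : MonoidAlgebra ℤ (StructureGroup k Λ) :=
  dimVector (projCover (FGMod.trivial k Λ))

variable (k Λ) in
/-- The canonical element as an element of `ℂ𝒮`. -/
noncomputable def canonicalElementC [IsBasicSplit k Λ] : MonoidAlgebra ℂ (StructureGroup k Λ) :=
  MonoidAlgebra.mapRingHom _ (Int.castRingHom ℂ) (canonicalElement k Λ)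

end Cover

end Modules

/-! ### The Fourier form -/

section Fourier

variable {G : Type*} [Group G] {t : ℕ} {n : Fin t → ℕ}

/-- For a finite abelian group `G` with generators `K i` of order `n i`, identified with the product
of the groups `ZMod (n i)` by `e`, and roots of unity `q i` of order `n i`, the number
`q^{ab} = ∏ i, q i ^ (a i * b i)` attached to `K^a` and `K^b`. -/
noncomputable def fourierPairing (e : Multiplicative (∀ i, ZMod (n i)) ≃* G) (q : Fin t → ℂ)
    (g h : G) : ℂ :=
  ∏ i, q i ^ (((e.symm g).toAdd i).val * ((e.symm h).toAdd i).val)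

/-- The bilinear form on `ℂG` with `β(K^a, K^b) = q^{ab}`. -/
noncomputable def fourierForm (e : Multiplicative (∀ i, ZMod (n i)) ≃* G) (q : Fin t → ℂ) :
    LinearMap.BilinForm ℂ (MonoidAlgebra ℂ G) :=
  (Finsupp.linearCombination ℂ fun g : G =>
    Finsupp.linearCombination ℂ (fourierPairing e q g) ∘ₗ
      (MonoidAlgebra.coeffLinearEquiv ℂ : MonoidAlgebra ℂ G ≃ₗ[ℂ] G →₀ ℂ).toLinearMap) ∘ₗ
    (MonoidAlgebra.coeffLinearEquiv ℂ : MonoidAlgebra ℂ G ≃ₗ[ℂ] G →₀ ℂ).toLinearMap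

/-- The element `K^a` for a tuple `a` of integers. -/
def genPow (e : Multiplicative (∀ i, ZMod (n i)) ≃* G) (a : Fin t → ℤ) : G :=
  e (Multiplicative.ofAdd fun i => (a i : ZMod (n i)))

theorem fourierForm_genPow [∀ i, NeZero (n i)] (e : Multiplicative (∀ i, ZMod (n i)) ≃* G)
    (q : Fin t → ℂ) (hq : ∀ i, IsPrimitiveRoot (q i) (n i)) (a b : Fin t → ℤ) :
    fourierForm e q (MonoidAlgebra.single (genPow e a) 1) (MonoidAlgebra.single (genPow e b) 1) =
      ∏ i, q i ^ (a i * b i) := by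
  have h : fourierForm e q (MonoidAlgebra.single (genPow e a) 1)
      (MonoidAlgebra.single (genPow e b) 1) = fourierPairing e q (genPow e a) (genPow e b) := by
    simp [fourierForm]
  rw [h, fourierPairing]
  refine Finset.prod_congr rfl fun i _ => ?_
  simp only [genPow, MulEquiv.symm_apply_apply, toAdd_ofAdd]
  have h0 : q i ≠ 0 := (hq i).ne_zero (NeZero.ne _)
  rw [← zpow_natCast, ← div_eq_one_iff_eq (zpow_ne_zero _ h0), ← zpow_sub₀ h0,
    (hq i).zpow_eq_one_iff_dvd, ← ZMod.intCast_zmod_eq_zero_iff_dvd]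
  simp

end Fourier

/-- The nilradical of a ring whose multiplication is commutative. -/
def nilradicalOfComm {R : Type*} [Ring R] (h : ∀ x y : R, x * y = y * x) : Set R :=
  letI : CommRing R := { (inferInstance : Ring R) with mul_comm := h }
  (nilradical R : Set R)

end HopfK0

open HopfK0

/-! Since Λ is split and basic, each simple module S is one-dimensional and given by a character χ
of Λ. Tensoring with S on the left twists the action by the automorphism a ↦ ∑ χ(a₍₁₎) a₍₂₎, on the
right by its mirror image, so it preserves projectivity. Thus S ⊗ P₁ and P₁ ⊗ S are projective, map
onto S and have the dimension of P₁. A second comparison through S* shows that P_S has this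
dimension too, so both are isomorphic to P_S.

Write p = [P₁] and let ι : ℂ𝒮 → R send S to [S]. Then p commutes with ι(ℂ𝒮) and Φ(v) = ι(v)p.
Tensoring a composition series of P₁ with P₁ gives short exact sequences with projective right ends
S ⊗ P₁. These split, so p² = ι(c)p (`trivialCoverClass_mul_self`), although K₀ only knows split
sequences. Hence R = ι(ℂ𝒮) + ι(ℂ𝒮)p (`exists_eq_simpleAlgHom_add`).

Linear independence comes from additive functions on modules. The multiplicity of S in the top shows
that Φ is injective. The multiplicity of S as a direct summand shows that either p = 1, or ι is
injective and ι(ℂ𝒮) meets ι(ℂ𝒮)p trivially (`trivialCoverClass_eq_one_or`).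

The nilradical is then pure algebra (`isNilpotent_iff_of_mul_self_eq`). The characters X_g = β(g, ·)
separate ℂ𝒮, so it is reduced. A nilpotent r = ι(t) + ι(v)p acts on p as t + vc, so t = -vc; it then
acts on p - ι(c) as -vc, which forces vc = 0 when p ≠ 1. So r = Φ(v) with vc = 0, that is, X_g(v) =
0 whenever X_g(c) ≠ 0. If p = 1, then c = 1 and r = 0. -/

namespace HopfK0

/-! ### Automorphisms of Λ given by characters. -/

section Twist

variable {k Λ : Type u} [Field k] [Ring Λ] [HopfAlgebra k Λ]

/-- The algebra endomorphism `a ↦ ∑ χ(a₍₁₎) a₍₂₎`. -/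
noncomputable def twistLeft (χ : Λ →ₐ[k] k) : Λ →ₐ[k] Λ :=
  (Algebra.TensorProduct.lid k Λ).toAlgHom.comp
    ((Algebra.TensorProduct.map χ (AlgHom.id k Λ)).comp (Bialgebra.comulAlgHom k Λ))

/-- The algebra endomorphism `a ↦ ∑ χ(a₍₂₎) a₍₁₎`. -/
noncomputable def twistRight (χ : Λ →ₐ[k] k) : Λ →ₐ[k] Λ :=
  (Algebra.TensorProduct.rid k k Λ).toAlgHom.comp
    ((Algebra.TensorProduct.map (AlgHom.id k Λ) χ).comp (Bialgebra.comulAlgHom k Λ))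

open WithConv in
theorem twistLeft_conv (χ : Λ →ₐ[k] k) :
    toConv (twistLeft χ).toLinearMap =
      toConv (Algebra.linearMap k Λ ∘ₗ χ.toLinearMap) * toConv LinearMap.id := by
  ext a
  simp only [LinearMap.convMul_apply, twistLeft]
  change TensorProduct.lid k Λ (TensorProduct.map χ.toLinearMap LinearMap.id
    (Coalgebra.comul (R := k) a)) = _
  generalize Coalgebra.comul (R := k) a = z
  induction z using TensorProduct.induction_on with
  | zero => simp
  | tmul x y => simp [Algebra.smul_def]
  | add x y hx hy => simp only [map_add, hx, hy]

open WithConv in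
theorem twistRight_conv (χ : Λ →ₐ[k] k) :
    toConv (twistRight χ).toLinearMap =
      toConv LinearMap.id * toConv (Algebra.linearMap k Λ ∘ₗ χ.toLinearMap) := by
  ext a
  simp only [LinearMap.convMul_apply, twistRight]
  change TensorProduct.rid k Λ (TensorProduct.map LinearMap.id χ.toLinearMap
    (Coalgebra.comul (R := k) a)) = _
  generalize Coalgebra.comul (R := k) a = z
  induction z using TensorProduct.induction_on with
  | zero => simp
  | tmul x y => simp [Algebra.smul_def, Algebra.commutes]
  | add x y hx hy => simp only [map_add, hx, hy]

-- Postcomposition with an algebra homomorphism is multiplicative for convolution. Applied to χ and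
-- the antipode identity, it makes χ ∘ S the convolution inverse of χ.
open WithConv in
theorem conv_antipode_mul_character (χ : Λ →ₐ[k] k) :
    toConv ((Algebra.linearMap k Λ ∘ₗ χ.toLinearMap) ∘ₗ HopfAlgebra.antipode k) *
      toConv (Algebra.linearMap k Λ ∘ₗ χ.toLinearMap) = 1 := by
  have h := LinearMap.algHom_comp_convMul_distrib ((Algebra.ofId k Λ).comp χ)
    (toConv (HopfAlgebra.antipode k (A := Λ))) (toConv LinearMap.id)
  rw [LinearMap.antipode_mul_id] at h
  refine (congrArg toConv h).symm.trans ?_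
  ext a
  simp [LinearMap.convOne_def, Algebra.ofId_apply]

open WithConv in
theorem conv_character_mul_antipode (χ : Λ →ₐ[k] k) :
    toConv (Algebra.linearMap k Λ ∘ₗ χ.toLinearMap) *
      toConv ((Algebra.linearMap k Λ ∘ₗ χ.toLinearMap) ∘ₗ HopfAlgebra.antipode k) = 1 := by
  have h := LinearMap.algHom_comp_convMul_distrib ((Algebra.ofId k Λ).comp χ)
    (toConv LinearMap.id) (toConv (HopfAlgebra.antipode k (A := Λ)))
  rw [LinearMap.id_mul_antipode] at h
  refine (congrArg toConv h).symm.trans ?_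
  ext a
  simp [LinearMap.convOne_def, Algebra.ofId_apply]

-- Let F = χ * id be the twist and f = χ ∘ S. As F is an algebra map that fixes scalars, F ∘ (f *
-- id) = f * F = f * χ * id = id, so f * id is a right inverse of F.
open WithConv in
theorem twistLeft_surjective (χ : Λ →ₐ[k] k) : Function.Surjective (twistLeft χ) := by
  let f : Λ →ₗ[k] Λ := (Algebra.linearMap k Λ ∘ₗ χ.toLinearMap) ∘ₗ HopfAlgebra.antipode k
  have h := LinearMap.algHom_comp_convMul_distrib (twistLeft χ) (toConv f) (toConv LinearMap.id)
  have h1 : toConv ((twistLeft χ).toLinearMap ∘ₗ (toConv f).ofConv) = toConv f := by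
    ext a
    simp [f]
  have h2 : toConv ((twistLeft χ).toLinearMap ∘ₗ
      (toConv (LinearMap.id : Λ →ₗ[k] Λ)).ofConv) = toConv (twistLeft χ).toLinearMap := by
    ext a
    simp
  rw [h1, h2, twistLeft_conv, ← mul_assoc, conv_antipode_mul_character, one_mul] at h
  exact fun a => ⟨_, LinearMap.congr_fun h a⟩

open WithConv in
theorem twistRight_surjective (χ : Λ →ₐ[k] k) : Function.Surjective (twistRight χ) := by
  let f : Λ →ₗ[k] Λ := (Algebra.linearMap k Λ ∘ₗ χ.toLinearMap) ∘ₗ HopfAlgebra.antipode k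
  have h := LinearMap.algHom_comp_convMul_distrib (twistRight χ) (toConv LinearMap.id) (toConv f)
  have h1 : toConv ((twistRight χ).toLinearMap ∘ₗ (toConv f).ofConv) = toConv f := by
    ext a
    simp [f]
  have h2 : toConv ((twistRight χ).toLinearMap ∘ₗ
      (toConv (LinearMap.id : Λ →ₗ[k] Λ)).ofConv) = toConv (twistRight χ).toLinearMap := by
    ext a
    simp
  rw [h1, h2, twistRight_conv, mul_assoc, conv_character_mul_antipode, mul_one] at h
  exact fun a => ⟨_, LinearMap.congr_fun h a⟩

/-- A surjective endomorphism of a finite dimensional algebra is an automorphism. -/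
theorem exists_ringEquiv_of_surjective [Module.Finite k Λ] (f : Λ →ₐ[k] Λ)
    (hf : Function.Surjective f) : ∃ σ : Λ ≃+* Λ, ∀ a, f (σ a) = a :=
  let τ := RingEquiv.ofBijective f.toRingHom
    ⟨(LinearMap.injective_iff_surjective (f := f.toLinearMap)).mpr hf, hf⟩
  ⟨τ.symm, τ.apply_symm_apply⟩

end Twist

/-! ### One-dimensional modules and characters. -/

section Character

variable {k Λ : Type u} [Field k] [Ring Λ] [Algebra k Λ]

/-- `Λ` acts on `M` through the character `χ`. -/
def FGMod.HasCharacter (M : FGMod k Λ) (χ : Λ →ₐ[k] k) : Prop :=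
  ∀ (a : Λ) (m : M.carrier), a • m = χ a • m

/-- The scalars already fill `Module.End k M.carrier`, so the action factors through k. -/
theorem FGMod.exists_hasCharacter (M : FGMod k Λ) (h : Module.finrank k M.carrier = 1) :
    ∃ χ : Λ →ₐ[k] k, M.HasCharacter χ := by
  have hn : Nontrivial M.carrier := Module.nontrivial_of_finrank_pos (R := k) (by omega)
  obtain ⟨x, hx⟩ := exists_ne (0 : M.carrier)
  have hspan : ∀ v : M.carrier, ∃ c : k, c • x = v := (finrank_eq_one_iff_of_nonzero' x hx).mp h
  have hb : Function.Bijective (Algebra.ofId k (Module.End k M.carrier)) := by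
    refine ⟨(Algebra.ofId k (Module.End k M.carrier)).injective, fun f => ?_⟩
    obtain ⟨c, hc⟩ := hspan (f x)
    refine ⟨c, LinearMap.ext fun v => ?_⟩
    obtain ⟨d, rfl⟩ := hspan v
    rw [Algebra.ofId_apply, Module.algebraMap_end_apply, map_smul, ← hc, smul_comm]
  let E := AlgEquiv.ofBijective _ hb
  refine ⟨(E.symm : Module.End k M.carrier →ₐ[k] k).comp (Algebra.lsmul k k M.carrier),
    fun a m => ?_⟩
  have h1 : E (E.symm (Algebra.lsmul k k M.carrier a)) m = a • m := by
    rw [AlgEquiv.apply_symm_apply]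
    rfl
  exact h1.symm

end Character

/-! ### Tensoring with one-dimensional modules preserves projectivity. -/

section Tensor

variable {k Λ : Type u} [Field k] [Ring Λ] [HopfAlgebra k Λ] [Module.Finite k Λ]

theorem FGMod.smul_tmul (M N : FGMod k Λ) (a : Λ) (m : M.carrier) (n : N.carrier) :
    (a • (show (M.tensor N).carrier from m ⊗ₜ[k] n) : (M.tensor N).carrier) =
      TensorProduct.map ((LinearMap.toSpanSingleton Λ _ m).restrictScalars k)
        ((LinearMap.toSpanSingleton Λ _ n).restrictScalars k) (Coalgebra.comul (R := k) a) :=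
  M.tensorAction_tmul N a m n

/-- The tensor product of two homomorphisms. -/
noncomputable def FGMod.tensorMap {M M' N N' : FGMod k Λ} (f : M.carrier →ₗ[Λ] M'.carrier)
    (g : N.carrier →ₗ[Λ] N'.carrier) : (M.tensor N).carrier →ₗ[Λ] (M'.tensor N').carrier where
  toFun := TensorProduct.map (f.restrictScalars k) (g.restrictScalars k)
  map_add' := map_add _
  map_smul' := fun a x => by
    let f' := f.restrictScalars k
    let g' := g.restrictScalars k
    refine LinearMap.congr_fun (f := (TensorProduct.map f' g') ∘ₗ (M.tensorAction N a))
      (g := (M'.tensorAction N' a) ∘ₗ (TensorProduct.map f' g')) ?_ x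
    refine TensorProduct.ext' fun m n => ?_
    simp only [LinearMap.comp_apply, FGMod.tensorAction_tmul, TensorProduct.map_tmul]
    generalize Coalgebra.comul (R := k) a = z
    induction z using TensorProduct.induction_on with
    | zero => simp
    | tmul x y => simp [f', g']
    | add x y hx hy => simp only [map_add, hx, hy]

/-- The module S ⊗ P is P with its action pulled back along an automorphism of Λ. -/
theorem FGMod.projective_tensor_left (S P : FGMod k Λ) (hS : Module.finrank k S.carrier = 1)
    (hP : Module.Projective Λ P.carrier) : Module.Projective Λ (S.tensor P).carrier := by
  obtain ⟨χ, hχ⟩ := S.exists_hasCharacter hS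
  have := S.finite_field
  obtain ⟨σ, hσ⟩ := exists_ringEquiv_of_surjective _ (twistLeft_surjective χ)
  let l : k ≃ₗ[k] S.carrier := LinearEquiv.ofFinrankEq k S.carrier (by rw [hS, Module.finrank_self])
  let e₀ : P.carrier ≃ₗ[k] S.carrier ⊗[k] P.carrier :=
    (TensorProduct.lid k P.carrier).symm.trans (TensorProduct.congr l (.refl k _))
  have he₀ : ∀ m, e₀ m = l 1 ⊗ₜ m := fun m => by simp [e₀]
  have hact : ∀ (a : Λ) (m : P.carrier),
      a • (show (S.tensor P).carrier from l 1 ⊗ₜ[k] m) = l 1 ⊗ₜ[k] (twistLeft χ a • m) :=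
    fun a m => by
    refine (S.smul_tmul P a (l 1) m).trans ?_
    change _ = l 1 ⊗ₜ[k] ((TensorProduct.lid k Λ (TensorProduct.map χ.toLinearMap LinearMap.id
      (Coalgebra.comul (R := k) a))) • m)
    generalize Coalgebra.comul (R := k) a = z
    induction z using TensorProduct.induction_on with
    | zero => simp
    | tmul y z => simp [hχ y, TensorProduct.smul_tmul]
    | add y z hy hz => simp only [map_add, hy, hz, add_smul, TensorProduct.tmul_add]
  have := RingHomInvPair.of_ringEquiv σ
  have := RingHomInvPair.of_ringEquiv σ.symm
  -- The map m ↦ l 1 ⊗ m is semilinear over σ, the inverse of the twist; projectivity passes along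
  -- semilinear equivalences.
  let e : P.carrier ≃ₛₗ[(σ : Λ →+* Λ)] (S.tensor P).carrier :=
    { e₀ with
      map_smul' := fun a m => by
        change e₀ (a • m) = (σ a) • (show (S.tensor P).carrier from e₀ m)
        rw [he₀, he₀, hact, hσ] }
  exact Module.Projective.of_equiv e

theorem FGMod.projective_tensor_right (P S : FGMod k Λ) (hS : Module.finrank k S.carrier = 1)
    (hP : Module.Projective Λ P.carrier) : Module.Projective Λ (P.tensor S).carrier := by
  obtain ⟨χ, hχ⟩ := S.exists_hasCharacter hS
  have := S.finite_field
  obtain ⟨σ, hσ⟩ := exists_ringEquiv_of_surjective _ (twistRight_surjective χ)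
  let l : k ≃ₗ[k] S.carrier := LinearEquiv.ofFinrankEq k S.carrier (by rw [hS, Module.finrank_self])
  let e₀ : P.carrier ≃ₗ[k] P.carrier ⊗[k] S.carrier :=
    (TensorProduct.rid k P.carrier).symm.trans (TensorProduct.congr (.refl k _) l)
  have he₀ : ∀ m, e₀ m = m ⊗ₜ l 1 := fun m => by simp [e₀]
  have hact : ∀ (a : Λ) (m : P.carrier),
      a • (show (P.tensor S).carrier from m ⊗ₜ[k] l 1) = (twistRight χ a • m) ⊗ₜ[k] l 1 :=
    fun a m => by
    refine (P.smul_tmul S a m (l 1)).trans ?_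
    change _ = ((TensorProduct.rid k Λ (TensorProduct.map LinearMap.id χ.toLinearMap
      (Coalgebra.comul (R := k) a))) • m) ⊗ₜ[k] l 1
    generalize Coalgebra.comul (R := k) a = z
    induction z using TensorProduct.induction_on with
    | zero => simp
    | tmul y z => simp [hχ z, TensorProduct.smul_tmul]
    | add y z hy hz => simp only [map_add, hy, hz, add_smul, TensorProduct.add_tmul]
  have := RingHomInvPair.of_ringEquiv σ
  have := RingHomInvPair.of_ringEquiv σ.symm
  let e : P.carrier ≃ₛₗ[(σ : Λ →+* Λ)] (P.tensor S).carrier :=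
    { e₀ with
      map_smul' := fun a m => by
        change e₀ (a • m) = (σ a) • (show (P.tensor S).carrier from e₀ m)
        rw [he₀, he₀, hact, hσ] }
  exact Module.Projective.of_equiv e

end Tensor

/-! ### Projective covers as direct summands. -/

section ProjectiveCovers

variable {k Λ : Type u} [Field k] [Ring Λ] [Algebra k Λ]

/-- A proper submodule of the projective cover of a simple module `S` lies in the kernel of the
covering map. -/
theorem IsProjectiveCover.le_ker {P S : FGMod k Λ} {ψ : P.carrier →ₗ[Λ] S.carrier}
    (hψ : IsProjectiveCover ψ) (hS : IsSimpleModule Λ S.carrier) {X : Submodule Λ P.carrier}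
    (hX : X ≠ ⊤) : X ≤ LinearMap.ker ψ := by
  by_contra hle
  refine hψ.essential X hX (LinearMap.surjective_of_ne_zero fun h0 => hle fun x hx => ?_)
  exact LinearMap.congr_fun h0 ⟨x, hx⟩

variable [Module.Finite k Λ]

/-- A submodule of a finitely generated module. -/
def FGMod.ofSubmodule (M : FGMod k Λ) (N : Submodule Λ M.carrier) : FGMod k Λ :=
  have := M.finite_field
  have : IsNoetherian Λ M.carrier := isNoetherian_of_tower k inferInstance
  { carrier := N }

/-- A projective module that maps onto `S` has the projective cover of `S` as a direct summand. -/
theorem exists_equiv_prod_projCover (P S : FGMod k Λ) (hP : Module.Projective Λ P.carrier)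
    (f : P.carrier →ₗ[Λ] S.carrier) (hf : Function.Surjective f) :
    ∃ X : FGMod k Λ, Module.Projective Λ X.carrier ∧
      Nonempty (P.carrier ≃ₗ[Λ] X.carrier × (projCover S).carrier) := by
  obtain ⟨ψ, hψ⟩ := projCover_spec S
  have := hψ.projective
  obtain ⟨g, hg⟩ := Module.projective_lifting_property ψ f hψ.surjective
  -- The range of g still maps onto S, so essentiality of ψ leaves no room for a proper range.
  have hgs : LinearMap.range g = ⊤ := by
    by_contra hne
    refine hψ.essential _ hne fun y => ?_
    obtain ⟨x, rfl⟩ := hf y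
    exact ⟨⟨g x, x, rfl⟩, LinearMap.congr_fun hg x⟩
  obtain ⟨s, hs⟩ := Module.projective_lifting_property g LinearMap.id
    (LinearMap.range_eq_top.mp hgs)
  let e := ((LinearMap.exact_subtype_ker_map g).splitSurjectiveEquiv
    (LinearMap.ker g).injective_subtype ⟨s, hs⟩).1
  have hX : Module.Projective Λ (LinearMap.ker g) :=
    Module.Projective.of_split (e.symm.toLinearMap ∘ₗ LinearMap.inl Λ _ _)
      (LinearMap.fst Λ _ _ ∘ₗ e.toLinearMap) (LinearMap.ext fun x => by simp)
  exact ⟨P.ofSubmodule (LinearMap.ker g), hX, ⟨e⟩⟩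

theorem finrank_eq_add_of_equiv_prod {P X Q : FGMod k Λ}
    (e : P.carrier ≃ₗ[Λ] X.carrier × Q.carrier) :
    Module.finrank k P.carrier = Module.finrank k X.carrier + Module.finrank k Q.carrier := by
  have := X.finite_field
  have := Q.finite_field
  rw [(e.restrictScalars k).finrank_eq, Module.finrank_prod]

theorem finrank_projCover_le (P S : FGMod k Λ) (hP : Module.Projective Λ P.carrier)
    (f : P.carrier →ₗ[Λ] S.carrier) (hf : Function.Surjective f) :
    Module.finrank k (projCover S).carrier ≤ Module.finrank k P.carrier := by
  obtain ⟨X, -, ⟨e⟩⟩ := exists_equiv_prod_projCover P S hP f hf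
  rw [finrank_eq_add_of_equiv_prod e]
  exact Nat.le_add_left _ _

/-- A projective module that maps onto `S` and is not larger than the projective cover of `S` is
isomorphic to it. -/
theorem nonempty_equiv_projCover (P S : FGMod k Λ) (hP : Module.Projective Λ P.carrier)
    (f : P.carrier →ₗ[Λ] S.carrier) (hf : Function.Surjective f)
    (h : Module.finrank k P.carrier ≤ Module.finrank k (projCover S).carrier) :
    Nonempty (P.carrier ≃ₗ[Λ] (projCover S).carrier) := by
  obtain ⟨X, -, ⟨e⟩⟩ := exists_equiv_prod_projCover P S hP f hf
  have := X.finite_field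
  have h0 : Module.finrank k X.carrier = 0 := by
    have := finrank_eq_add_of_equiv_prod e
    omega
  have : Subsingleton X.carrier := Module.finrank_zero_iff.mp h0
  have : Unique X.carrier := uniqueOfSubsingleton 0
  exact ⟨e.trans LinearEquiv.uniqueProd⟩

end ProjectiveCovers

/-! ### Classes in the Grothendieck ring. -/

section K0Basics

variable {k Λ : Type u} [Field k] [Ring Λ] [HopfAlgebra k Λ] [Module.Finite k Λ]

theorem FGMod.k0_eq_of_cls_eq {M N : FGMod k Λ} (h : M.cls = N.cls) : M.k0 = N.k0 := by
  rw [FGMod.k0, h, FGMod.k0]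

theorem FGMod.k0_eq_of_equiv {M N : FGMod k Λ} (e : M.carrier ≃ₗ[Λ] N.carrier) : M.k0 = N.k0 :=
  FGMod.k0_eq_of_cls_eq (Quotient.sound ⟨e⟩)

theorem FGMod.k0_mul (M N : FGMod k Λ) : M.k0 * N.k0 = (M.tensor N).k0 := by
  change RingQuot.mkRingHom (SplitRel k Λ) _ * RingQuot.mkRingHom (SplitRel k Λ) _ = _
  rw [← map_mul, ← map_mul]
  rfl

theorem FGMod.k0_trivial : (FGMod.trivial k Λ).k0 = 1 := by
  change RingQuot.mkRingHom (SplitRel k Λ) (MonoidAlgebra.of ℤ _ 1) = _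
  rw [map_one, map_one]
  rfl

theorem FGMod.k0_eq_add_of_split {X₁ X₂ X₃ : FGMod k Λ} (i : X₁.carrier →ₗ[Λ] X₂.carrier)
    (p : X₂.carrier →ₗ[Λ] X₃.carrier) (s : X₃.carrier →ₗ[Λ] X₂.carrier)
    (hi : Function.Injective i) (hip : Function.Exact i p) (hs : p ∘ₗ s = LinearMap.id) :
    X₂.k0 = X₁.k0 + X₃.k0 := by
  have hp : Function.Surjective p := fun x => ⟨s x, LinearMap.congr_fun hs x⟩
  exact (RingQuot.mkRingHom_rel (SplitRel.mk X₁ X₂ X₃ i p s hi hip hp hs)).trans (map_add _ _ _)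

theorem FGMod.k0_eq_add_of_projective {X₁ X₂ X₃ : FGMod k Λ} (i : X₁.carrier →ₗ[Λ] X₂.carrier)
    (p : X₂.carrier →ₗ[Λ] X₃.carrier) (hi : Function.Injective i) (hip : Function.Exact i p)
    (hp : Function.Surjective p) (h3 : Module.Projective Λ X₃.carrier) :
    X₂.k0 = X₁.k0 + X₃.k0 := by
  obtain ⟨s, hs⟩ := Module.projective_lifting_property p LinearMap.id hp
  exact FGMod.k0_eq_add_of_split i p s hi hip hs

theorem FGMod.k0_eq_add_of_equiv_prod {X₁ X₂ X₃ : FGMod k Λ}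
    (e : X₂.carrier ≃ₗ[Λ] X₁.carrier × X₃.carrier) : X₂.k0 = X₁.k0 + X₃.k0 := by
  refine FGMod.k0_eq_add_of_split (e.symm.toLinearMap ∘ₗ LinearMap.inl Λ _ _)
    (LinearMap.snd Λ _ _ ∘ₗ e.toLinearMap) (e.symm.toLinearMap ∘ₗ LinearMap.inr Λ _ _)
    (e.symm.injective.comp LinearMap.inl_injective) ?_ ?_
  · intro x
    obtain ⟨⟨y, z⟩, rfl⟩ := e.symm.surjective x
    simp [eq_comm]
  · ext x
    simp

theorem FGMod.k0_of_subsingleton (M : FGMod k Λ) [Subsingleton M.carrier] : M.k0 = 0 := by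
  -- For the zero module the sequence M → M → M of zero maps is split exact, so [M] = [M] + [M].
  have h := FGMod.k0_eq_add_of_split (X₁ := M) (X₂ := M) (X₃ := M) 0 0 0
    (Function.injective_of_subsingleton _) (fun x => ⟨fun _ => ⟨x, Subsingleton.elim _ _⟩,
      fun _ => Subsingleton.elim _ _⟩) (LinearMap.ext fun _ => Subsingleton.elim _ _)
  exact left_eq_add.mp h

/-- Induction on the dimension: a simple submodule has a complement of smaller dimension. -/
theorem FGMod.k0_mem_closure_of_isSemisimple (M : FGMod k Λ)
    (hM : IsSemisimpleModule Λ M.carrier) :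
    M.k0 ∈ AddSubmonoid.closure
      {x | ∃ S : FGMod k Λ, IsSimpleModule Λ S.carrier ∧ x = S.k0} := by
  induction hd : Module.finrank k M.carrier using Nat.strong_induction_on generalizing M with
  | _ d ih =>
    have := M.finite_field
    rcases subsingleton_or_nontrivial M.carrier with h | h
    · rw [M.k0_of_subsingleton]
      exact zero_mem _
    · obtain ⟨S, hS⟩ := IsSemisimpleModule.exists_simple_submodule Λ M.carrier
      obtain ⟨X, hX⟩ := exists_isCompl S
      have e := (Submodule.prodEquivOfIsCompl X S hX.symm).symm
      rw [FGMod.k0_eq_add_of_equiv_prod (X₁ := M.ofSubmodule X) (X₃ := M.ofSubmodule S) e]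
      have hf := finrank_eq_add_of_equiv_prod (X := M.ofSubmodule X) (Q := M.ofSubmodule S) e
      have : Nontrivial (M.ofSubmodule S).carrier := IsSimpleModule.nontrivial Λ S
      have := (M.ofSubmodule S).finite_field
      have hpos : 0 < Module.finrank k (M.ofSubmodule S).carrier := Module.finrank_pos
      refine add_mem (ih _ (by omega) _ ?_ rfl) (AddSubmonoid.subset_closure ⟨_, hS, rfl⟩)
      exact inferInstanceAs (IsSemisimpleModule Λ X)

/-- A maximal submodule gives a simple quotient, whose projective cover splits off with a smaller
projective complement. Uniqueness of the decomposition is not needed. -/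
theorem FGMod.k0_mem_closure_of_projective (P : FGMod k Λ)
    (hP : Module.Projective Λ P.carrier) :
    P.k0 ∈ AddSubmonoid.closure
      {x | ∃ S : FGMod k Λ, IsSimpleModule Λ S.carrier ∧ x = (projCover S).k0} := by
  induction hd : Module.finrank k P.carrier using Nat.strong_induction_on generalizing P with
  | _ d ih =>
    have := P.finite_field
    rcases subsingleton_or_nontrivial P.carrier with h | h
    · rw [P.k0_of_subsingleton]
      exact zero_mem _
    · have : IsCoatomic (Submodule Λ P.carrier) :=
        have : IsNoetherian Λ P.carrier := isNoetherian_of_tower k inferInstance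
        inferInstance
      obtain ⟨m, hm, -⟩ :=
        (eq_top_or_exists_le_coatom (⊥ : Submodule Λ P.carrier)).resolve_left bot_ne_top
      let S : FGMod k Λ := { carrier := P.carrier ⧸ m }
      have hS : IsSimpleModule Λ S.carrier := isSimpleModule_iff_isCoatom.mpr hm
      obtain ⟨X, hX, ⟨e⟩⟩ := exists_equiv_prod_projCover P S hP m.mkQ m.mkQ_surjective
      rw [FGMod.k0_eq_add_of_equiv_prod e]
      have hf := finrank_eq_add_of_equiv_prod e
      obtain ⟨ψ, hψ⟩ := projCover_spec S
      have : Nontrivial S.carrier := IsSimpleModule.nontrivial Λ S.carrier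
      have : Nontrivial (projCover S).carrier := hψ.surjective.nontrivial
      have := (projCover S).finite_field
      have hpos : 0 < Module.finrank k (projCover S).carrier := Module.finrank_pos
      exact add_mem (ih _ (by omega) _ hX rfl) (AddSubmonoid.subset_closure ⟨_, hS, rfl⟩)

end K0Basics

/-! ### Products of simple modules and projective covers. -/

section SimpleTensor

variable {k Λ : Type u} [Field k] [Ring Λ] [HopfAlgebra k Λ] [Module.Finite k Λ]

theorem FGMod.finrank_tensor (M N : FGMod k Λ) :
    Module.finrank k (M.tensor N).carrier =
      Module.finrank k M.carrier * Module.finrank k N.carrier :=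
  Module.finrank_tensorProduct (R := k) (S := k) (M := M.carrier) (M' := N.carrier)

theorem FGMod.tensorMap_surjective {M M' N N' : FGMod k Λ} {f : M.carrier →ₗ[Λ] M'.carrier}
    {g : N.carrier →ₗ[Λ] N'.carrier} (hf : Function.Surjective f) (hg : Function.Surjective g) :
    Function.Surjective (FGMod.tensorMap f g) :=
  TensorProduct.map_surjective (g := f.restrictScalars k) (g' := g.restrictScalars k) hf hg

/-- Tensoring an exact sequence with a module `P` such that `X₃ ⊗ P` is projective. -/
theorem FGMod.k0_mul_eq_add_of_exact {X₁ X₂ X₃ : FGMod k Λ} (P : FGMod k Λ)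
    (i : X₁.carrier →ₗ[Λ] X₂.carrier) (p : X₂.carrier →ₗ[Λ] X₃.carrier)
    (hi : Function.Injective i) (hip : Function.Exact i p) (hp : Function.Surjective p)
    (h : Module.Projective Λ (X₃.tensor P).carrier) :
    X₂.k0 * P.k0 = X₁.k0 * P.k0 + X₃.k0 * P.k0 := by
  simp only [FGMod.k0_mul]
  -- The original sequence need not split. Tensoring over a field keeps it exact, and the projective
  -- right end then splits it.
  exact FGMod.k0_eq_add_of_projective (FGMod.tensorMap i .id) (FGMod.tensorMap p .id)
    (Module.Flat.rTensor_preserves_injective_linearMap (M := P.carrier)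
      (i.restrictScalars k) hi)
    (rTensor_exact P.carrier (f := i.restrictScalars k) (g := p.restrictScalars k) hip hp)
    (FGMod.tensorMap_surjective hp Function.surjective_id) h

variable [IsBasicSplit k Λ]

/-- If `P` is projective, then `[M][P]` is the sum of the `[S][P]` over the
composition factors `S` of `M`. -/
theorem FGMod.k0_mul_eq_sum (M P : FGMod k Λ) (hP : Module.Projective Λ P.carrier)
    (σ : CompositionSeries (Submodule Λ M.carrier)) (hb : σ.head = ⊥) (ht : σ.last = ⊤) :
    M.k0 * P.k0 =
      ∑ i : Fin σ.length, (M.subquotient (σ i.castSucc) (σ i.succ)).k0 * P.k0 := by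
  have step : ∀ i : Fin σ.length, (M.ofSubmodule (σ i.succ)).k0 * P.k0 =
      (M.ofSubmodule (σ i.castSucc)).k0 * P.k0 +
        (M.subquotient (σ i.castSucc) (σ i.succ)).k0 * P.k0 := fun i => by
    have hle : σ i.castSucc ≤ σ i.succ := (σ.step i).le
    have hs : IsSimpleModule Λ (M.subquotient (σ i.castSucc) (σ i.succ)).carrier :=
      (covBy_iff_quot_is_simple hle).mp (σ.step i)
    have hex : Function.Exact (Submodule.inclusion hle)
        (Submodule.mkQ ((σ i.castSucc).submoduleOf (σ i.succ))) := by
      rw [LinearMap.exact_iff, Submodule.ker_mkQ, Submodule.range_inclusion]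
      rfl
    exact FGMod.k0_mul_eq_add_of_exact P
      (X₁ := M.ofSubmodule (σ i.castSucc)) (X₂ := M.ofSubmodule (σ i.succ))
      (X₃ := M.subquotient (σ i.castSucc) (σ i.succ))
      (Submodule.inclusion hle) (Submodule.mkQ _) (Submodule.inclusion_injective hle) hex
      (Submodule.mkQ_surjective _)
      (FGMod.projective_tensor_left _ P (FGMod.finrank_eq_one _ hs) hP)
  -- Telescoping: the term σ j collects exactly the factors with index below j.
  have key : ∀ j : Fin (σ.length + 1), (M.ofSubmodule (σ j)).k0 * P.k0 =
      ∑ i : Fin σ.length with i.castSucc < j,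
        (M.subquotient (σ i.castSucc) (σ i.succ)).k0 * P.k0 := by
    intro j
    induction j using Fin.induction with
    | zero =>
      have h0 : σ 0 = ⊥ := hb
      have : Subsingleton (M.ofSubmodule (σ 0)).carrier :=
        (Submodule.subsingleton_iff_eq_bot (p := σ 0)).mpr h0
      rw [FGMod.k0_of_subsingleton, zero_mul]
      simp
    | succ j ih =>
      rw [step, ih]
      have : (Finset.univ.filter fun i : Fin σ.length => i.castSucc < j.succ) =
          insert j (Finset.univ.filter fun i : Fin σ.length => i.castSucc < j.castSucc) := by
        ext i
        simp only [Finset.mem_filter, Finset.mem_univ, true_and, Finset.mem_insert, Fin.ext_iff,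
          Fin.lt_def, Fin.val_succ, Fin.val_castSucc]
        omega
      rw [this, Finset.sum_insert (by simp), add_comm]
  have e : (M.ofSubmodule (σ (Fin.last _))).carrier ≃ₗ[Λ] M.carrier :=
    (LinearEquiv.ofEq _ _ ht).trans Submodule.topEquiv
  rw [← FGMod.k0_eq_of_equiv e, key]
  refine Finset.sum_congr (Finset.filter_true_of_mem fun i _ => ?_) fun _ _ => rfl
  exact Fin.castSucc_lt_last i

/-- S ⊗ P₁ maps onto S ⊗ k ≅ S and S* ⊗ P_S maps onto S* ⊗ S ≅ k. One-dimensional tensor factors do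
not change the dimension, so minimality of projective covers gives both inequalities. -/
theorem finrank_projCover_eq (S : FGMod k Λ) (hS : IsSimpleModule Λ S.carrier) :
    Module.finrank k (projCover S).carrier =
      Module.finrank k (projCover (FGMod.trivial k Λ)).carrier := by
  have hS1 := S.finrank_eq_one hS
  have hD1 := S.dual.finrank_eq_one (S.dual_isSimple hS)
  refine le_antisymm ?_ ?_
  · obtain ⟨ψ, hψ⟩ := projCover_spec (FGMod.trivial k Λ)
    obtain ⟨e⟩ := Quotient.exact S.tensor_trivial
    have h := finrank_projCover_le (S.tensor (projCover (FGMod.trivial k Λ))) S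
      (FGMod.projective_tensor_left S _ hS1 hψ.projective)
      (e.toLinearMap ∘ₗ FGMod.tensorMap .id ψ)
      (e.surjective.comp (FGMod.tensorMap_surjective Function.surjective_id hψ.surjective))
    rwa [FGMod.finrank_tensor, hS1, one_mul] at h
  · obtain ⟨ψ, hψ⟩ := projCover_spec S
    obtain ⟨e⟩ := Quotient.exact (S.dual_tensor hS1)
    have h := finrank_projCover_le (S.dual.tensor (projCover S)) (FGMod.trivial k Λ)
      (FGMod.projective_tensor_left S.dual _ hD1 hψ.projective)
      (e.toLinearMap ∘ₗ FGMod.tensorMap .id ψ)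
      (e.surjective.comp (FGMod.tensorMap_surjective Function.surjective_id hψ.surjective))
    rwa [FGMod.finrank_tensor, hD1, one_mul] at h

theorem FGMod.k0_mul_projCover_trivial (S : FGMod k Λ) (hS : IsSimpleModule Λ S.carrier) :
    S.k0 * (projCover (FGMod.trivial k Λ)).k0 = (projCover S).k0 := by
  have hS1 := S.finrank_eq_one hS
  obtain ⟨ψ, hψ⟩ := projCover_spec (FGMod.trivial k Λ)
  obtain ⟨e⟩ := Quotient.exact S.tensor_trivial
  obtain ⟨f⟩ := nonempty_equiv_projCover (S.tensor (projCover (FGMod.trivial k Λ))) S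
    (FGMod.projective_tensor_left S _ hS1 hψ.projective)
    (e.toLinearMap ∘ₗ FGMod.tensorMap .id ψ)
    (e.surjective.comp (FGMod.tensorMap_surjective Function.surjective_id hψ.surjective))
    (by rw [FGMod.finrank_tensor, hS1, one_mul, finrank_projCover_eq S hS])
  rw [FGMod.k0_mul, FGMod.k0_eq_of_equiv f]

/-- Together with `FGMod.k0_mul_projCover_trivial` this makes [P₁] commute with all simple classes,
even when 𝒮 is not abelian. -/
theorem FGMod.projCover_trivial_mul_k0 (S : FGMod k Λ) (hS : IsSimpleModule Λ S.carrier) :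
    (projCover (FGMod.trivial k Λ)).k0 * S.k0 = (projCover S).k0 := by
  have hS1 := S.finrank_eq_one hS
  obtain ⟨ψ, hψ⟩ := projCover_spec (FGMod.trivial k Λ)
  obtain ⟨e⟩ := Quotient.exact S.trivial_tensor
  obtain ⟨f⟩ := nonempty_equiv_projCover ((projCover (FGMod.trivial k Λ)).tensor S) S
    (FGMod.projective_tensor_right _ S hS1 hψ.projective)
    (e.toLinearMap ∘ₗ FGMod.tensorMap ψ .id)
    (e.surjective.comp (FGMod.tensorMap_surjective hψ.surjective Function.surjective_id))
    (by rw [FGMod.finrank_tensor, hS1, mul_one, finrank_projCover_eq S hS])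
  rw [FGMod.k0_mul, FGMod.k0_eq_of_equiv f]

end SimpleTensor

/-! ### Additive functions descend to the Grothendieck group. -/

section Additive

variable {k Λ : Type u} [Field k] [Ring Λ] [HopfAlgebra k Λ] [Module.Finite k Λ]

/-- An integer-valued function on modules that is additive on split exact sequences. -/
structure SplitAdditive (d : FGMod k Λ → ℤ) : Prop where
  iso : ∀ M N : FGMod k Λ, Nonempty (M.carrier ≃ₗ[Λ] N.carrier) → d M = d N
  split : ∀ (X₁ X₂ X₃ : FGMod k Λ) (i : X₁.carrier →ₗ[Λ] X₂.carrier)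
    (p : X₂.carrier →ₗ[Λ] X₃.carrier) (s : X₃.carrier →ₗ[Λ] X₂.carrier),
    Function.Injective i → Function.Exact i p → p ∘ₗ s = LinearMap.id → d X₂ = d X₁ + d X₃

theorem FGMod.tensorMap_comp_eq_id {M M' N N' : FGMod k Λ} {f : M.carrier →ₗ[Λ] M'.carrier}
    {f' : M'.carrier →ₗ[Λ] M.carrier} {g : N.carrier →ₗ[Λ] N'.carrier}
    {g' : N'.carrier →ₗ[Λ] N.carrier} (hf : f ∘ₗ f' = LinearMap.id)
    (hg : g ∘ₗ g' = LinearMap.id) :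
    FGMod.tensorMap f g ∘ₗ FGMod.tensorMap f' g' = LinearMap.id := by
  have h1 : f.restrictScalars k ∘ₗ f'.restrictScalars k = LinearMap.id :=
    LinearMap.ext fun y => LinearMap.congr_fun hf y
  have h2 : g.restrictScalars k ∘ₗ g'.restrictScalars k = LinearMap.id :=
    LinearMap.ext fun y => LinearMap.congr_fun hg y
  have h3 : TensorProduct.map (f.restrictScalars k) (g.restrictScalars k) ∘ₗ
      TensorProduct.map (f'.restrictScalars k) (g'.restrictScalars k) = LinearMap.id := by
    rw [← TensorProduct.map_comp, h1, h2, TensorProduct.map_id]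
  exact LinearMap.ext fun x => LinearMap.congr_fun h3 x

theorem SplitAdditive.tensor_right {d : FGMod k Λ → ℤ} (hd : SplitAdditive d) (N : FGMod k Λ) :
    SplitAdditive fun M => d (M.tensor N) where
  iso := fun M M' ⟨e⟩ => hd.iso _ _ (Quotient.exact (FGMod.tensor_congr e (.refl Λ N.carrier)))
  split := fun X₁ X₂ X₃ i p s hi hip hs => by
    have hp : Function.Surjective p := fun x => ⟨s x, LinearMap.congr_fun hs x⟩
    exact hd.split _ _ _ (FGMod.tensorMap i .id) (FGMod.tensorMap p .id) (FGMod.tensorMap s .id)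
      (Module.Flat.rTensor_preserves_injective_linearMap (M := N.carrier)
        (i.restrictScalars k) hi)
      (rTensor_exact N.carrier (f := i.restrictScalars k) (g := p.restrictScalars k) hip hp)
      (FGMod.tensorMap_comp_eq_id hs (LinearMap.id_comp _))

theorem SplitAdditive.tensor_left {d : FGMod k Λ → ℤ} (hd : SplitAdditive d) (N : FGMod k Λ) :
    SplitAdditive fun M => d (N.tensor M) where
  iso := fun M M' ⟨e⟩ => hd.iso _ _ (Quotient.exact (FGMod.tensor_congr (.refl Λ N.carrier) e))
  split := fun X₁ X₂ X₃ i p s hi hip hs => by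
    have hp : Function.Surjective p := fun x => ⟨s x, LinearMap.congr_fun hs x⟩
    exact hd.split _ _ _ (FGMod.tensorMap .id i) (FGMod.tensorMap .id p) (FGMod.tensorMap .id s)
      (Module.Flat.lTensor_preserves_injective_linearMap (M := N.carrier)
        (i.restrictScalars k) hi)
      (lTensor_exact N.carrier (f := i.restrictScalars k) (g := p.restrictScalars k) hip hp)
      (FGMod.tensorMap_comp_eq_id (LinearMap.id_comp _) hs)

/-- The additive extension to the free abelian group on the isomorphism classes. -/
noncomputable def SplitAdditive.freeHom {d : FGMod k Λ → ℤ} (hd : SplitAdditive d) :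
    MonoidAlgebra ℤ (IsoClass k Λ) →ₗ[ℤ] ℤ :=
  Finsupp.linearCombination ℤ (Quotient.lift d hd.iso : IsoClass k Λ → ℤ) ∘ₗ
    (MonoidAlgebra.coeffLinearEquiv ℤ : _ ≃ₗ[ℤ] IsoClass k Λ →₀ ℤ).toLinearMap

theorem SplitAdditive.freeHom_of {d : FGMod k Λ → ℤ} (hd : SplitAdditive d) (M : FGMod k Λ) :
    hd.freeHom (MonoidAlgebra.of ℤ _ M.cls) = d M := by
  refine (Finsupp.linearCombination_single ℤ (1 : ℤ) M.cls).trans ?_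
  exact one_smul ℤ (d M)

/-- `RingQuot.Rel` is closed under multiplication on either side; quantifying over both factors u
and v lets the induction pass through these closure steps. -/
theorem SplitAdditive.freeHom_rel {d : FGMod k Λ → ℤ} (hd : SplitAdditive d)
    {x y : MonoidAlgebra ℤ (IsoClass k Λ)} (h : RingQuot.Rel (SplitRel k Λ) x y) :
    ∀ u v, hd.freeHom (u * x * v) = hd.freeHom (u * y * v) := by
  induction h with
  | of h =>
    obtain ⟨X₁, X₂, X₃, i, p, s, hi, hip, hp, hs⟩ := h
    intro u v
    -- By linearity u and v may be taken to be classes [M] and [N]; then X ↦ d((M ⊗ X) ⊗ N) is again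
    -- additive on split sequences.
    induction u using MonoidAlgebra.induction_on with
    | add a b ha hb => simp only [add_mul, map_add, ha, hb]
    | smul r a ha => simp only [smul_mul_assoc, map_smul, ha]
    | of m =>
    induction v using MonoidAlgebra.induction_on with
    | add a b ha hb => simp only [mul_add, map_add, ha, hb]
    | smul r a ha => simp only [mul_smul_comm, map_smul, ha]
    | of n =>
    obtain ⟨M⟩ := m
    obtain ⟨N⟩ := n
    have key : ∀ X : FGMod k Λ, hd.freeHom (MonoidAlgebra.of ℤ _ M.cls *
        MonoidAlgebra.of ℤ _ X.cls * MonoidAlgebra.of ℤ _ N.cls) = d ((M.tensor X).tensor N) :=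
      fun X => by
        rw [← map_mul, ← map_mul, IsoClass.cls_mul, IsoClass.cls_mul, hd.freeHom_of]
    change hd.freeHom (MonoidAlgebra.of ℤ _ M.cls * _ * MonoidAlgebra.of ℤ _ N.cls) =
      hd.freeHom (MonoidAlgebra.of ℤ _ M.cls * _ * MonoidAlgebra.of ℤ _ N.cls)
    rw [mul_add, add_mul, map_add, key, key, key]
    exact ((hd.tensor_right N).tensor_left M).split X₁ X₂ X₃ i p s hi hip hs
  | add_left _ ih => intro u v; simp only [mul_add, add_mul, map_add, ih]
  | mul_left _ ih => intro u v; simpa only [mul_assoc] using! ih u (_ * v)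
  | mul_right _ ih => intro u v; simpa only [mul_assoc] using! ih (u * _) v

theorem SplitAdditive.freeHom_eq {d : FGMod k Λ → ℤ} (hd : SplitAdditive d)
    {x y : MonoidAlgebra ℤ (IsoClass k Λ)}
    (h : RingQuot.mkRingHom (SplitRel k Λ) x = RingQuot.mkRingHom (SplitRel k Λ) y) :
    hd.freeHom x = hd.freeHom y := by
  have h' : Relation.EqvGen (RingQuot.Rel (SplitRel k Λ)) x y := by
    simp only [RingQuot.mkRingHom_def] at h
    exact Quot.eqvGen_exact (congrArg RingQuot.toQuot h)
  clear h
  induction h' with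
  | rel x y h => simpa using hd.freeHom_rel h 1 1
  | refl => rfl
  | symm _ _ _ ih => exact ih.symm
  | trans _ _ _ _ _ ih1 ih2 => exact ih1.trans ih2

variable (k Λ) in
/-- The quotient map onto the Grothendieck ring. -/
noncomputable def K0.mkHom : MonoidAlgebra ℤ (IsoClass k Λ) →+* K0 k Λ :=
  RingQuot.mkRingHom (SplitRel k Λ)

theorem K0.mkHom_of (M : FGMod k Λ) : K0.mkHom k Λ (MonoidAlgebra.of ℤ _ M.cls) = M.k0 := rfl

/-- The homomorphism on the Grothendieck group given by an additive function. -/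
theorem SplitAdditive.exists_hom {d : FGMod k Λ → ℤ} (hd : SplitAdditive d) :
    ∃ φ : K0 k Λ →+ ℤ, ∀ M : FGMod k Λ, φ M.k0 = d M := by
  let π : MonoidAlgebra ℤ (IsoClass k Λ) →+ K0 k Λ := (K0.mkHom k Λ).toAddMonoidHom
  have hπ : Function.Surjective π := RingQuot.mkRingHom_surjective _
  have hker : π.ker ≤ hd.freeHom.toAddMonoidHom.ker := fun x hx => by
    have := hd.freeHom_eq (x := x) (y := 0) (Eq.trans hx (map_zero (K0.mkHom k Λ)).symm)
    rwa [map_zero] at this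
  refine ⟨π.liftOfSurjective hπ ⟨hd.freeHom.toAddMonoidHom, hker⟩, fun M => ?_⟩
  refine (AddMonoidHom.liftOfRightInverse_comp_apply π (Function.surjInv hπ)
    (Function.rightInverse_surjInv hπ) ⟨hd.freeHom.toAddMonoidHom, hker⟩
    (MonoidAlgebra.of ℤ _ M.cls)).trans ?_
  exact hd.freeHom_of M

/-- A family of subspaces of the modules that is preserved by all homomorphisms. -/
structure NaturalSubspace (k Λ : Type u) [Field k] [Ring Λ] [Algebra k Λ] where
  obj : ∀ M : FGMod k Λ, Submodule k M.carrier
  map : ∀ {M N : FGMod k Λ} (f : M.carrier →ₗ[Λ] N.carrier) {x : M.carrier},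
    x ∈ obj M → f x ∈ obj N

/-- Naturality under the inclusions and projections of a splitting gives E(X₂) ≅ E(X₁) ⊕ E(X₃). -/
theorem NaturalSubspace.splitAdditive (E : NaturalSubspace k Λ) :
    SplitAdditive fun M : FGMod k Λ => (Module.finrank k (E.obj M) : ℤ) where
  iso := fun M N ⟨e⟩ => by
    have h : E.obj N = (E.obj M).map (e.restrictScalars k).toLinearMap := by
      ext y
      refine ⟨fun hy => ⟨e.symm y, E.map e.symm.toLinearMap hy, e.apply_symm_apply y⟩, ?_⟩
      rintro ⟨x, hx, rfl⟩
      exact E.map e.toLinearMap hx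
    rw [h, LinearEquiv.finrank_map_eq]
  split := fun X₁ X₂ X₃ i p s hi hip hs => by
    have := X₂.finite_field
    have hps : ∀ x, p (s x) = x := LinearMap.congr_fun hs
    let P : E.obj X₂ →ₗ[k] E.obj X₃ := (p.restrictScalars k).restrict fun x hx => E.map p hx
    have hP : LinearMap.range P = ⊤ := by
      rw [LinearMap.range_eq_top]
      rintro ⟨x, hx⟩
      exact ⟨⟨s x, E.map s hx⟩, Subtype.ext (hps x)⟩
    let I : E.obj X₁ →ₗ[k] E.obj X₂ := (i.restrictScalars k).restrict fun x hx => E.map i hx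
    have hI : Function.Injective I := fun x y h => Subtype.ext (hi (congrArg Subtype.val h))
    -- This defines the retraction r of i with i r + s p = 1; naturality under r keeps preimages
    -- inside E(X₁).
    have hr : ∀ x, ∃ y, i y = x - s (p x) := fun x => (hip _).mp (by rw [map_sub, hps, sub_self])
    choose r hr using hr
    let r' : X₂.carrier →ₗ[Λ] X₁.carrier :=
      { toFun := r
        map_add' := fun x y => hi (by rw [map_add, hr, hr, hr, map_add, map_add]; abel)
        map_smul' := fun a x => hi (by
          rw [RingHom.id_apply, map_smul, hr, hr, map_smul, map_smul, smul_sub]) }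
    have hIP : LinearMap.ker P = LinearMap.range I := by
      ext ⟨x, hx⟩
      constructor
      · intro h
        have h0 : p x = 0 := congrArg Subtype.val h
        refine ⟨⟨r x, E.map r' hx⟩, Subtype.ext ?_⟩
        change i (r x) = x
        rw [hr, h0, map_zero, sub_zero]
      · rintro ⟨y, hy⟩
        rw [← hy]
        exact Subtype.ext (hip.apply_apply_eq_zero y)
    have h := P.finrank_range_add_finrank_ker
    rw [hP, finrank_top, hIP, LinearMap.finrank_range_of_inj hI] at h
    omega

end Additive

/-! ### Invariants and coinvariants of a character. -/

section Multiplicity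

variable {k Λ : Type u} [Field k] [Ring Λ] [Algebra k Λ]

/-- The submodule of `M` generated by the elements `a • m - χ(a) • m`. -/
def FGMod.coinvariantKer (M : FGMod k Λ) (χ : Λ →ₐ[k] k) : Submodule Λ M.carrier :=
  Submodule.span Λ {y | ∃ (a : Λ) (m : M.carrier), y = a • m - χ a • m}

theorem FGMod.smul_sub_mem_coinvariantKer (M : FGMod k Λ) (χ : Λ →ₐ[k] k) (a : Λ)
    (m : M.carrier) : a • m - χ a • m ∈ M.coinvariantKer χ :=
  Submodule.subset_span ⟨a, m, rfl⟩

/-- Every map to a module with character χ factors through the quotient by `coinvariantKer`. -/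
theorem FGMod.coinvariantKer_le_ker {M N : FGMod k Λ} {χ : Λ →ₐ[k] k} (hN : N.HasCharacter χ)
    (f : M.carrier →ₗ[Λ] N.carrier) : M.coinvariantKer χ ≤ LinearMap.ker f := by
  refine Submodule.span_le.mpr ?_
  rintro _ ⟨a, m, rfl⟩
  rw [SetLike.mem_coe, LinearMap.mem_ker, map_sub, map_smul, LinearMap.map_smul_of_tower, hN,
    sub_self]

/-- The family of the submodules generated by the elements `a • m - χ(a) • m`. -/
def coinvariantSubspace (χ : Λ →ₐ[k] k) : NaturalSubspace k Λ where
  obj := fun M => (M.coinvariantKer χ).restrictScalars k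
  map := fun {M N} f {x} hx => by
    refine (Submodule.span_le (p := (N.coinvariantKer χ).comap f)).mpr ?_ hx
    rintro _ ⟨a, m, rfl⟩
    rw [SetLike.mem_coe, Submodule.mem_comap, map_sub, map_smul, LinearMap.map_smul_of_tower]
    exact N.smul_sub_mem_coinvariantKer χ a (f m)

/-- The family of the subspaces on which `Λ` acts through `χ`. -/
def invariantSubspace (χ : Λ →ₐ[k] k) : NaturalSubspace k Λ where
  obj := fun M =>
    { carrier := {m | ∀ a : Λ, a • m = χ a • m}
      add_mem' := fun {x y} hx hy a => by rw [smul_add, hx, hy, smul_add]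
      zero_mem' := fun a => by rw [smul_zero, smul_zero]
      smul_mem' := fun c x hx a => by rw [smul_comm, hx, smul_comm] }
  map := fun {M N} f {x} hx a => by
    rw [← map_smul, hx, LinearMap.map_smul_of_tower]

/-- The family of the whole modules. -/
def topSubspace : NaturalSubspace k Λ where
  obj := fun _ => ⊤
  map := fun _ _ _ => Submodule.mem_top

/-- The intersection of two families. -/
def NaturalSubspace.inf (E F : NaturalSubspace k Λ) : NaturalSubspace k Λ where
  obj := fun M => E.obj M ⊓ F.obj M
  map := fun f _ hx => ⟨E.map f hx.1, F.map f hx.2⟩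

theorem FGMod.HasCharacter.coinvariantKer_eq_top {S : FGMod k Λ} {χ χ' : Λ →ₐ[k] k}
    (hS : S.HasCharacter χ') (hne : χ ≠ χ') : S.coinvariantKer χ = ⊤ := by
  obtain ⟨a, ha⟩ := DFunLike.ne_iff.mp hne
  refine eq_top_iff.mpr fun x _ => ?_
  have h := S.smul_sub_mem_coinvariantKer χ a ((χ' a - χ a)⁻¹ • x)
  rwa [hS, ← sub_smul, smul_inv_smul₀ (sub_ne_zero.mpr ha.symm)] at h

/-- If `coinvariantKer` is proper, it lies in ker ψ, so Λ acts on a nonzero vector of S through both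
χ and χ'. If χ = χ', it lies in ker ψ anyway. -/
theorem IsProjectiveCover.coinvariantKer_eq_top_iff {P S : FGMod k Λ} {χ χ' : Λ →ₐ[k] k}
    {ψ : P.carrier →ₗ[Λ] S.carrier} (hψ : IsProjectiveCover ψ)
    (hS : IsSimpleModule Λ S.carrier) (hχ : S.HasCharacter χ') :
    P.coinvariantKer χ = ⊤ ↔ χ ≠ χ' := by
  have : Nontrivial S.carrier := IsSimpleModule.nontrivial Λ S.carrier
  obtain ⟨y, hy⟩ := exists_ne (0 : S.carrier)
  obtain ⟨x, rfl⟩ := hψ.surjective y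
  constructor
  · rintro h rfl
    exact hy (FGMod.coinvariantKer_le_ker hχ ψ (h.ge Submodule.mem_top))
  · intro h
    by_contra hne
    refine h (AlgHom.ext fun a => ?_)
    have h0 := hψ.le_ker hS hne (P.smul_sub_mem_coinvariantKer χ a x)
    rw [LinearMap.mem_ker, map_sub, map_smul, LinearMap.map_smul_of_tower, hχ, ← sub_smul,
      smul_eq_zero_iff_left hy] at h0
    exact (sub_eq_zero.mp h0).symm

/-- An invariant vector m outside `coinvariantKer` would span a direct summand of P. But all proper
submodules lie in ker ψ, so P is not the sum of two of them. -/
theorem IsProjectiveCover.invariant_le_coinvariant {P S : FGMod k Λ} (χ : Λ →ₐ[k] k)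
    {ψ : P.carrier →ₗ[Λ] S.carrier} (hψ : IsProjectiveCover ψ)
    (hS : IsSimpleModule Λ S.carrier) (hP : Module.finrank k P.carrier ≠ 1) :
    (invariantSubspace χ).obj P ≤ (coinvariantSubspace χ).obj P := by
  have : Nontrivial S.carrier := IsSimpleModule.nontrivial Λ S.carrier
  intro m hm
  by_contra hmX
  obtain ⟨f, hfm, hfX⟩ : ∃ f : Module.Dual k P.carrier, f m ≠ 0 ∧
      ∀ x ∈ P.coinvariantKer χ, f x = 0 := by
    obtain ⟨f, hf, hfX⟩ := Submodule.exists_le_ker_of_notMem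
      (p := (P.coinvariantKer χ).restrictScalars k) hmX
    exact ⟨f, hf, fun x hx => hfX hx⟩
  have hfs : ∀ (a : Λ) x, f (a • x) = χ a * f x := fun a x => by
    have := hfX _ (P.smul_sub_mem_coinvariantKer χ a x)
    rwa [map_sub, f.map_smul, smul_eq_mul, sub_eq_zero] at this
  -- The functional f is Λ-linear with values in the module of χ, so its kernel is a submodule; it
  -- is a complement of the line Y through m.
  let W : Submodule Λ P.carrier :=
    { (LinearMap.ker f).toAddSubmonoid with
      smul_mem' := fun a x (hx : f x = 0) => by
        change f (a • x) = 0
        rw [hfs, hx, mul_zero] }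
  have hW : W ≠ ⊤ := fun h => hfm (h.ge (Submodule.mem_top : m ∈ (⊤ : Submodule Λ P.carrier)) : m ∈ W)
  let Y : Submodule Λ P.carrier :=
    { (k ∙ m).toAddSubmonoid with
      smul_mem' := fun a x hx => by
        obtain ⟨c, rfl⟩ := Submodule.mem_span_singleton.mp hx
        refine Submodule.mem_span_singleton.mpr ⟨χ a * c, ?_⟩
        rw [smul_comm, hm a, smul_smul, mul_comm] }
  have hm0 : m ≠ 0 := fun h => hfm (by rw [h, map_zero])
  have hY : Y ≠ ⊤ := fun h => hP <| finrank_eq_one m hm0 fun w =>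
    Submodule.mem_span_singleton.mp (h.ge (Submodule.mem_top : w ∈ (⊤ : Submodule Λ P.carrier)) : w ∈ Y)
  have hψm : ψ m = 0 := hψ.le_ker hS hY (Submodule.mem_span_singleton_self m : m ∈ k ∙ m)
  obtain ⟨y, hy⟩ := exists_ne (0 : S.carrier)
  obtain ⟨x, rfl⟩ := hψ.surjective y
  have hx : x - (f x / f m) • m ∈ W := by
    change f (x - (f x / f m) • m) = 0
    rw [map_sub, map_smul, smul_eq_mul, div_mul_cancel₀ _ hfm, sub_self]
  have h0 := hψ.le_ker hS hW hx
  rw [LinearMap.mem_ker, map_sub, LinearMap.map_smul_of_tower, hψm, smul_zero, sub_zero] at h0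
  exact hy h0

theorem FGMod.HasCharacter.coinvariantKer_eq_bot {S : FGMod k Λ} {χ : Λ →ₐ[k] k}
    (hS : S.HasCharacter χ) : S.coinvariantKer χ = ⊥ :=
  le_bot_iff.mp ((FGMod.coinvariantKer_le_ker hS LinearMap.id).trans LinearMap.ker_id.le)

theorem FGMod.HasCharacter.invariant_le_coinvariant_iff {S : FGMod k Λ} [Nontrivial S.carrier]
    {χ χ' : Λ →ₐ[k] k} (hS : S.HasCharacter χ') :
    (invariantSubspace χ).obj S ≤ (coinvariantSubspace χ).obj S ↔ χ ≠ χ' := by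
  constructor
  · rintro h rfl
    obtain ⟨y, hy⟩ := exists_ne (0 : S.carrier)
    have hy' : y ∈ S.coinvariantKer χ := h (fun a => hS a y)
    rw [hS.coinvariantKer_eq_bot] at hy'
    exact hy hy'
  · intro h x _
    exact (hS.coinvariantKer_eq_top h).ge Submodule.mem_top

end Multiplicity

/-! ### Additive functions that detect simple modules and projective covers. -/

section Detect

variable {k Λ : Type u} [Field k] [Ring Λ] [HopfAlgebra k Λ] [Module.Finite k Λ]

/-- The function is dim E(M) - dim (E ∩ F)(M). With F the coinvariant kernel of χ, taking E to be
all of M measures χ in the top of M, and taking E to be the χ-invariants measures χ as a direct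
summand. -/
theorem exists_hom_eq_zero_iff (E F : NaturalSubspace k Λ) :
    ∃ φ : K0 k Λ →+ ℤ, ∀ M : FGMod k Λ, φ M.k0 = 0 ↔ E.obj M ≤ F.obj M := by
  obtain ⟨φ, hφ⟩ := E.splitAdditive.exists_hom
  obtain ⟨φ', hφ'⟩ := (E.inf F).splitAdditive.exists_hom
  refine ⟨φ - φ', fun M => ?_⟩
  have := M.finite_field
  rw [AddMonoidHom.sub_apply, hφ, hφ', sub_eq_zero, Nat.cast_inj]
  constructor
  · intro h
    have := Submodule.eq_of_le_of_finrank_eq (inf_le_left : E.obj M ⊓ F.obj M ≤ E.obj M) h.symm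
    exact inf_eq_left.mp this
  · intro h
    exact congrArg (fun X : Submodule k M.carrier => Module.finrank k X) (inf_eq_left.mpr h).symm

/-- A one-dimensional P₁ is simple, so its nonzero covering map is an isomorphism. -/
theorem k0_projCover_trivial_eq_one
    (h : Module.finrank k (projCover (FGMod.trivial k Λ)).carrier = 1) :
    (projCover (FGMod.trivial k Λ)).k0 = 1 := by
  obtain ⟨ψ, hψ⟩ := projCover_spec (FGMod.trivial k Λ)
  have := FGMod.isSimple_of_finrank_eq_one _ h
  have := FGMod.trivial_isSimple (k := k) (Λ := Λ)
  have : Nontrivial (FGMod.trivial k Λ).carrier :=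
    IsSimpleModule.nontrivial Λ (FGMod.trivial k Λ).carrier
  have hb : Function.Bijective ψ := LinearMap.bijective_of_ne_zero fun h0 => by
    obtain ⟨y, hy⟩ := exists_ne (0 : (FGMod.trivial k Λ).carrier)
    obtain ⟨x, rfl⟩ := hψ.surjective y
    exact hy (LinearMap.congr_fun h0 x)
  rw [FGMod.k0_eq_of_equiv (LinearEquiv.ofBijective ψ hb), FGMod.k0_trivial]

variable [IsBasicSplit k Λ]

theorem StructureGroup.exists_character (s : StructureGroup k Λ) :
    ∃ χ : Λ →ₐ[k] k, s.rep.HasCharacter χ :=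
  s.rep.exists_hasCharacter (s.rep.finrank_eq_one s.rep_spec.1)

/-- The character through which `Λ` acts on the simple modules in a class. -/
noncomputable def StructureGroup.character (s : StructureGroup k Λ) : Λ →ₐ[k] k :=
  s.exists_character.choose

theorem StructureGroup.hasCharacter (s : StructureGroup k Λ) : s.rep.HasCharacter s.character :=
  s.exists_character.choose_spec

theorem StructureGroup.character_injective :
    Function.Injective (StructureGroup.character : StructureGroup k Λ → Λ →ₐ[k] k) := by
  intro s t h
  have h1 := s.rep.finrank_eq_one s.rep_spec.1
  have h2 := t.rep.finrank_eq_one t.rep_spec.1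
  have := s.rep.finite_field
  have := t.rep.finite_field
  refine Subtype.ext ?_
  rw [← s.rep_spec.2, ← t.rep_spec.2]
  refine FGMod.cls_eq _ _ (LinearEquiv.ofFinrankEq _ _ (h1.trans h2.symm)) fun a m => ?_
  rw [s.hasCharacter, t.hasCharacter, map_smul, h]

/-- The multiplicity of `s` in the top of a module distinguishes the projective covers. -/
theorem StructureGroup.exists_top_hom (s : StructureGroup k Λ) :
    ∃ φ : K0 k Λ →+ ℤ, ∀ t : StructureGroup k Λ, φ (projCover t.rep).k0 = 0 ↔ t ≠ s := by
  obtain ⟨φ, hφ⟩ := exists_hom_eq_zero_iff (k := k) (Λ := Λ) topSubspace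
    (coinvariantSubspace s.character)
  refine ⟨φ, fun t => ?_⟩
  obtain ⟨ψ, hψ⟩ := projCover_spec t.rep
  rw [hφ, ← StructureGroup.character_injective.ne_iff, ne_comm,
    ← hψ.coinvariantKer_eq_top_iff t.rep_spec.1 t.hasCharacter]
  exact top_le_iff.trans (Submodule.restrictScalars_eq_top_iff k Λ _)

/-- The multiplicity of `s` as a direct summand distinguishes the simple modules and vanishes on
the projective covers if these are not simple. -/
theorem StructureGroup.exists_summand_hom (s : StructureGroup k Λ) :
    ∃ φ : K0 k Λ →+ ℤ, (∀ t : StructureGroup k Λ, φ t.rep.k0 = 0 ↔ t ≠ s) ∧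
      (Module.finrank k (projCover (FGMod.trivial k Λ)).carrier ≠ 1 →
        ∀ t : StructureGroup k Λ, φ (projCover t.rep).k0 = 0) := by
  obtain ⟨φ, hφ⟩ := exists_hom_eq_zero_iff (k := k) (Λ := Λ) (invariantSubspace s.character)
    (coinvariantSubspace s.character)
  refine ⟨φ, fun t => ?_, fun hd t => ?_⟩
  · have : Nontrivial t.rep.carrier :=
      have := t.rep_spec.1
      IsSimpleModule.nontrivial Λ t.rep.carrier
    rw [hφ, ← StructureGroup.character_injective.ne_iff, ne_comm]
    exact t.hasCharacter.invariant_le_coinvariant_iff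
  · obtain ⟨ψ, hψ⟩ := projCover_spec t.rep
    rw [hφ]
    refine hψ.invariant_le_coinvariant _ t.rep_spec.1 ?_
    rwa [finrank_projCover_eq _ t.rep_spec.1]

end Detect

/-! ### Nilpotent elements of a ring generated by ι(A) and p with p² = ι(c)p. -/

section Nilpotent

variable {A R K I : Type*} [CommRing A] [CommRing R] [Field K]

/-- The nilpotent elements of a commutative ring `R = ι(A) + ι(A) p` with `p² = ι(c) p`, where the
elements of `A` are separated by homomorphisms to a field, `ι(A) p` is free over `A`, and either
`p = 1` or `ι(A)` and `ι(A) p` intersect trivially. -/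
theorem isNilpotent_iff_of_mul_self_eq (ι : A →+* R) (p : R) (c : A) (X : I → A →+* K)
    (hX : ∀ v, (∀ i, X i v = 0) → v = 0) (hp : p * p = ι c * p)
    (hinj : ∀ v, ι v * p = 0 → v = 0) (hspan : ∀ r, ∃ a b, r = ι a + ι b * p)
    (hdisj : p = 1 ∨ ∀ a b, ι a = ι b * p → a = 0) (r : R) :
    IsNilpotent r ↔ ∃ v, (∀ i, X i c ≠ 0 → X i v = 0) ∧ ι v * p = r := by
  -- A is reduced because homomorphisms to a field separate its elements.
  have hred : ∀ (a : A) (n : ℕ), a ^ n = 0 → a = 0 := fun a n h => hX a fun i =>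
    eq_zero_of_pow_eq_zero (by rw [← map_pow, h, map_zero] : X i a ^ n = 0)
  constructor
  · rintro ⟨n, hn⟩
    obtain ⟨t, v, hr⟩ := hspan r
    have hw : t + v * c = 0 := by
      -- On ι(A)p, multiplication by r is multiplication by t + vc, so nilpotency and freeness make
      -- t + vc nilpotent.
      have h1 : r * p = ι (t + v * c) * p := by
        rw [hr, map_add, map_mul]
        linear_combination ι v * hp
      have h2 : ∀ m : ℕ, r ^ m * p = ι ((t + v * c) ^ m) * p := by
        intro m
        induction m with
        | zero => rw [pow_zero, pow_zero, map_one]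
        | succ m ih =>
          rw [pow_succ' (t + v * c), map_mul, mul_assoc, ← ih, pow_succ]
          linear_combination r ^ m * h1
      refine hred _ n (hinj _ ?_)
      rw [← h2, hn, zero_mul]
    rcases hdisj with h1 | hd
    -- If p = 1, the relation p² = ι(c)p forces c = 1, so r = ι(t + v) = 0 and v = 0 serves as
    -- witness.
    · have hc : c - 1 = 0 := hinj _ (by rw [map_sub, map_one, sub_mul, ← hp, h1]; simp)
      rw [sub_eq_zero.mp hc, mul_one] at hw
      refine ⟨0, fun i _ => map_zero _, ?_⟩
      rw [hr, h1, map_zero, zero_mul, mul_one, ← map_add, hw, map_zero]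
    · have ht : t = -(v * c) := eq_neg_of_add_eq_zero_left hw
      -- The second eigenvector: p kills p - ι(c), so r acts on it as t = -vc.
      have h1 : r * (p - ι c) = ι (-(v * c)) * (p - ι c) := by
        rw [hr, ht, map_neg, map_mul]
        linear_combination ι v * hp
      have h2 : ∀ m : ℕ, r ^ m * (p - ι c) = ι ((-(v * c)) ^ m) * (p - ι c) := by
        intro m
        induction m with
        | zero => rw [pow_zero, pow_zero, map_one]
        | succ m ih =>
          rw [pow_succ' (-(v * c)), map_mul, mul_assoc, ← ih, pow_succ]
          linear_combination r ^ m * h1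
      -- From rⁿ = 0 follows ι((-vc)ⁿ c) = ι((-vc)ⁿ)p, which lies in the trivial intersection.
      have h3 : (-(v * c)) ^ n * c = 0 := by
        refine hd _ ((-(v * c)) ^ n) ?_
        have := h2 n
        rw [hn, zero_mul, mul_sub] at this
        rw [map_mul]
        exact (sub_eq_zero.mp this.symm).symm
      have h4 : v * c = 0 := by
        refine neg_eq_zero.mp (hred _ (n + 1) ?_)
        rw [pow_succ]
        linear_combination (-v) * h3
      refine ⟨v, fun i hi => ?_, ?_⟩
      · have := congrArg (X i) h4
        rw [map_mul, map_zero] at this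
        exact (mul_eq_zero.mp this).resolve_right hi
      · rw [hr, ht, h4, neg_zero, map_zero, zero_add]
  · rintro ⟨v, hv, rfl⟩
    have h0 : v * c = 0 := hX _ fun i => by
      rw [map_mul, mul_eq_zero]
      exact or_iff_not_imp_right.mpr (hv i)
    have h1 : ι v * ι c = 0 := by rw [← map_mul, h0, map_zero]
    -- Indeed (ι(v)p)² = ι(v²c)p = 0.
    exact ⟨2, by linear_combination (ι v) ^ 2 * hp + ι v * p * h1⟩

end Nilpotent

/-! ### The Fourier form and the characters of 𝒮. -/

section FourierCharacters

variable {G : Type*} [Group G] {t : ℕ} {n : Fin t → ℕ}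

/-- The characters `K^b ↦ q^{ab}`. -/
noncomputable def fourierCharacter (hn : ∀ i, 0 < n i)
    (e : Multiplicative (∀ i, ZMod (n i)) ≃* G) (q : Fin t → ℂ)
    (hq : ∀ i, IsPrimitiveRoot (q i) (n i)) (g : G) : G →* ℂ where
  toFun := fourierPairing e q g
  map_one' := by simp [fourierPairing]
  map_mul' := fun x y => by
    rw [fourierPairing, fourierPairing, fourierPairing, ← Finset.prod_mul_distrib]
    refine Finset.prod_congr rfl fun i _ => ?_
    have : NeZero (n i) := ⟨(hn i).ne'⟩
    rw [map_mul, toAdd_mul, Pi.add_apply, ZMod.val_add, pow_mul, pow_mul, pow_mul, ← pow_add]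
    -- `ZMod.val_add` reduces the exponent modulo n i, which is harmless because q i has order n i.
    refine (pow_eq_pow_mod _ ?_).symm
    rw [← pow_mul, mul_comm, pow_mul, (hq i).pow_eq_one, one_pow]

theorem fourierPairing_comm (e : Multiplicative (∀ i, ZMod (n i)) ≃* G) (q : Fin t → ℂ)
    (g h : G) : fourierPairing e q g h = fourierPairing e q h g := by
  simp only [fourierPairing, mul_comm]

/-- Evaluation at the i-th generator gives q i to the power of the i-th exponent, and primitivity
recovers that exponent modulo n i. -/
theorem fourierCharacter_injective (hn : ∀ i, 0 < n i)
    (e : Multiplicative (∀ i, ZMod (n i)) ≃* G) (q : Fin t → ℂ)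
    (hq : ∀ i, IsPrimitiveRoot (q i) (n i)) :
    Function.Injective (fourierCharacter hn e q hq) := by
  intro x y hxy
  refine e.symm.injective (Multiplicative.toAdd.injective (funext fun i => ?_))
  have : NeZero (n i) := ⟨(hn i).ne'⟩
  have key : ∀ z : G, fourierPairing e q z (e (Multiplicative.ofAdd (Pi.single i 1))) =
      q i ^ (((e.symm z).toAdd i).val * (1 : ZMod (n i)).val) := fun z => by
    rw [fourierPairing, Finset.prod_eq_single i]
    · rw [MulEquiv.symm_apply_apply, toAdd_ofAdd, Pi.single_eq_same]
    · intro j _ hj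
      rw [MulEquiv.symm_apply_apply, toAdd_ofAdd, Pi.single_eq_of_ne hj, ZMod.val_zero, mul_zero,
        pow_zero]
    · simp
  have h : fourierPairing e q x (e (Multiplicative.ofAdd (Pi.single i 1))) =
      fourierPairing e q y (e (Multiplicative.ofAdd (Pi.single i 1))) :=
    DFunLike.congr_fun hxy _
  rw [key, key] at h
  -- For n i = 1 the value of 1 in `ZMod 1` is 0, so the evaluation carries no information; but that
  -- factor is trivial.
  rcases (Nat.succ_le_of_lt (hn i)).eq_or_lt with h1 | h1
  · have : Subsingleton (ZMod (n i)) := by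
      rw [← h1]
      exact inferInstanceAs (Subsingleton (Fin 1))
    exact Subsingleton.elim _ _
  · rw [ZMod.val_one'' h1.ne', mul_one, mul_one] at h
    exact ZMod.val_injective _ ((hq i).pow_inj (ZMod.val_lt _) (ZMod.val_lt _) h)

/-- This turns B_c into the set of g whose character does not vanish on c. -/
theorem fourierForm_single (hn : ∀ i, 0 < n i)
    (e : Multiplicative (∀ i, ZMod (n i)) ≃* G) (q : Fin t → ℂ)
    (hq : ∀ i, IsPrimitiveRoot (q i) (n i)) (g : G) (v : MonoidAlgebra ℂ G) :
    fourierForm e q (MonoidAlgebra.single g 1) v =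
      MonoidAlgebra.lift ℂ ℂ G (fourierCharacter hn e q hq g) v := by
  induction v using MonoidAlgebra.induction_on with
  | of h => simp [fourierForm, fourierCharacter]
  | add a b ha hb => rw [map_add, map_add, ha, hb]
  | smul c a ha => rw [map_smul, map_smul, ha]

/-- The characters separate the elements of the group algebra. -/
theorem eq_zero_of_lift_fourierCharacter (hn : ∀ i, 0 < n i)
    (e : Multiplicative (∀ i, ZMod (n i)) ≃* G) (q : Fin t → ℂ)
    (hq : ∀ i, IsPrimitiveRoot (q i) (n i)) (v : MonoidAlgebra ℂ G)
    (hv : ∀ g, MonoidAlgebra.lift ℂ ℂ G (fourierCharacter hn e q hq g) v = 0) : v = 0 := by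
  have hli := (linearIndependent_monoidHom G ℂ).comp _ (fourierCharacter_injective hn e q hq)
  refine (MonoidAlgebra.coeffLinearEquiv ℂ : MonoidAlgebra ℂ G ≃ₗ[ℂ] G →₀ ℂ).injective ?_
  rw [map_zero]
  -- By symmetry of the pairing, X_g(v) is the value at g of the combination ∑ v_x X_x; independence
  -- of distinct characters then kills all v_x.
  refine linearIndependent_iff.mp hli _ (funext fun g => ?_)
  have h := hv g
  rw [MonoidAlgebra.lift_apply] at h
  rw [Finsupp.linearCombination_apply, Finsupp.sum_apply', Pi.zero_apply, ← h]
  refine Finsupp.sum_congr fun x _ => ?_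
  exact congrArg (fun z : ℂ => (MonoidAlgebra.coeffLinearEquiv ℂ v : G →₀ ℂ) x • z)
    (fourierPairing_comm e q x g)

theorem mem_orthogonal_span_single_iff (hn : ∀ i, 0 < n i)
    (e : Multiplicative (∀ i, ZMod (n i)) ≃* G) (q : Fin t → ℂ)
    (hq : ∀ i, IsPrimitiveRoot (q i) (n i)) (T : Set G) (v : MonoidAlgebra ℂ G) :
    v ∈ (fourierForm e q).orthogonal
        (Submodule.span ℂ ((fun x => MonoidAlgebra.single x (1 : ℂ)) '' T)) ↔
      ∀ g ∈ T, MonoidAlgebra.lift ℂ ℂ G (fourierCharacter hn e q hq g) v = 0 := by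
  rw [LinearMap.BilinForm.mem_orthogonal_iff]
  constructor
  · intro h g hg
    rw [← fourierForm_single]
    exact h _ (Submodule.subset_span ⟨g, hg, rfl⟩)
  · intro h x hx
    refine (Submodule.span_le (p := LinearMap.ker ((fourierForm e q).flip v))).mpr ?_ hx
    rintro _ ⟨g, hg, rfl⟩
    exact (fourierForm_single hn e q hq g v).trans (h g hg)

end FourierCharacters

/-! ### Group algebra generalities. -/

section GroupAlgebra

theorem linearMap_apply_eq_coeff_mul {G : Type*} (L : MonoidAlgebra ℂ G →ₗ[ℂ] ℂ) (s : G)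
    (h : ∀ t, t ≠ s → L (MonoidAlgebra.single t 1) = 0) (v : MonoidAlgebra ℂ G) :
    L v = v.coeff s * L (MonoidAlgebra.single s 1) := by
  classical
  induction v using MonoidAlgebra.induction_linear with
  | zero => simp
  | add a b ha hb => rw [map_add, ha, hb, MonoidAlgebra.coeff_add, Finsupp.add_apply, add_mul]
  | single t a =>
    have ha : (MonoidAlgebra.single t a : MonoidAlgebra ℂ G) = a • MonoidAlgebra.single t 1 := by
      simp
    rw [ha, map_smul, smul_eq_mul, MonoidAlgebra.coeff_smul, Finsupp.smul_apply,
      MonoidAlgebra.coeff_single]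
    by_cases hts : t = s
    · subst hts
      simp
    · rw [h t hts, Finsupp.single_eq_of_ne (Ne.symm hts)]
      simp

theorem monoidAlgebra_mul_comm {G : Type*} [Monoid G] (hab : ∀ s t : G, s * t = t * s)
    (a b : MonoidAlgebra ℂ G) : a * b = b * a := by
  induction a using MonoidAlgebra.induction_on with
  | add x y hx hy => rw [add_mul, mul_add, hx, hy]
  | smul c x hx => rw [smul_mul_assoc, mul_smul_comm, hx]
  | of s =>
    induction b using MonoidAlgebra.induction_on with
    | add x y hx hy => rw [add_mul, mul_add, hx, hy]
    | smul c x hx => rw [smul_mul_assoc, mul_smul_comm, hx]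
    | of t => rw [← map_mul, ← map_mul, hab]

end GroupAlgebra

/-! ### The structure of ℂ ⊗ K₀ᵖ(Λ). -/

section ProjectiveClassRing

variable {k Λ : Type u} [Field k] [Ring Λ] [HopfAlgebra k Λ] [Module.Finite k Λ]

/-- An element of `K₀ᵖ(Λ)` as an element of `ℂ ⊗ K₀ᵖ(Λ)`. -/
noncomputable def K0p.toComplex : K0p k Λ →+* CK0p k Λ :=
  (Algebra.TensorProduct.includeRight : K0p k Λ →ₐ[ℤ] CK0p k Λ).toRingHom

/-- The `ℂ`-linear extension of a homomorphism from the Grothendieck group to `ℤ`. -/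
noncomputable def complexify (φ : K0 k Λ →+ ℤ) : CK0p k Λ →ₗ[ℂ] ℂ :=
  (TensorProduct.AlgebraTensorModule.rid ℤ ℂ ℂ).toLinearMap ∘ₗ
    (φ.comp (K0p k Λ).subtype.toAddMonoidHom).toIntLinearMap.baseChange ℂ

theorem complexify_toComplex (φ : K0 k Λ →+ ℤ) (x : K0p k Λ) :
    complexify φ (K0p.toComplex x) = φ x := by
  simp [complexify, K0p.toComplex]

theorem projClass_eq_toComplex (P : FGMod k Λ) (h : Module.Projective Λ P.carrier) :
    projClass P h = K0p.toComplex ⟨P.k0, Subring.subset_closure ⟨P, Or.inl h, rfl⟩⟩ := rfl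

theorem complexify_projClass (φ : K0 k Λ →+ ℤ) (P : FGMod k Λ)
    (h : Module.Projective Λ P.carrier) : complexify φ (projClass P h) = φ P.k0 := by
  rw [projClass_eq_toComplex, complexify_toComplex]

theorem StructureGroup.k0_rep (s : StructureGroup k Λ) :
    s.rep.k0 = K0.mkHom k Λ (MonoidAlgebra.of ℤ _ s.1) := by
  rw [← K0.mkHom_of, s.rep_spec.2]

theorem StructureGroup.k0_rep_mk (S : FGMod k Λ) (hS : IsSimpleModule Λ S.carrier) :
    (StructureGroup.mk S hS).rep.k0 = S.k0 :=
  FGMod.k0_eq_of_cls_eq (StructureGroup.mk S hS).rep_spec.2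

variable [IsBasicSplit k Λ]

/-- The homomorphism `s ↦ [s]`. -/
noncomputable def simpleHom : StructureGroup k Λ →* K0p k Λ where
  toFun := fun s => ⟨s.rep.k0, Subring.subset_closure ⟨s.rep, Or.inr
    (have := s.rep_spec.1; inferInstance), rfl⟩⟩
  map_one' := Subtype.ext <| (StructureGroup.k0_rep_mk _ FGMod.trivial_isSimple).trans
    FGMod.k0_trivial
  map_mul' := fun s t => Subtype.ext <| by
    change (s * t).rep.k0 = s.rep.k0 * t.rep.k0
    rw [StructureGroup.k0_rep, StructureGroup.k0_rep, StructureGroup.k0_rep, ← map_mul, ← map_mul]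
    rfl

variable (k Λ) in
/-- The homomorphism `ℂ𝒮 → ℂ ⊗ K₀ᵖ(Λ)` with `s ↦ 1 ⊗ [s]`. -/
noncomputable def simpleAlgHom : MonoidAlgebra ℂ (StructureGroup k Λ) →ₐ[ℂ] CK0p k Λ :=
  MonoidAlgebra.lift ℂ _ _ ((K0p.toComplex : K0p k Λ →+* CK0p k Λ).toMonoidHom.comp simpleHom)

theorem simpleAlgHom_single (s : StructureGroup k Λ) (a : ℂ) :
    simpleAlgHom k Λ (MonoidAlgebra.single s a) = a • K0p.toComplex (simpleHom s) := by
  rw [simpleAlgHom, MonoidAlgebra.lift_single]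
  rfl

variable (k Λ) in
/-- The class of the projective cover of the trivial module. -/
noncomputable def trivialCoverClass : CK0p k Λ :=
  projClass (projCover (FGMod.trivial k Λ)) (projCover_projective _)

theorem simpleAlgHom_single_mul (s : StructureGroup k Λ) :
    simpleAlgHom k Λ (MonoidAlgebra.single s 1) * trivialCoverClass k Λ =
      projClass (projCover s.rep) (projCover_projective s.rep) := by
  rw [simpleAlgHom_single, one_smul, trivialCoverClass, projClass_eq_toComplex,
    projClass_eq_toComplex, ← map_mul]
  exact congrArg _ (Subtype.ext (s.rep.k0_mul_projCover_trivial s.rep_spec.1))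

theorem mul_simpleAlgHom_single (s : StructureGroup k Λ) :
    trivialCoverClass k Λ * simpleAlgHom k Λ (MonoidAlgebra.single s 1) =
      projClass (projCover s.rep) (projCover_projective s.rep) := by
  rw [simpleAlgHom_single, one_smul, trivialCoverClass, projClass_eq_toComplex,
    projClass_eq_toComplex, ← map_mul]
  exact congrArg _ (Subtype.ext (s.rep.projCover_trivial_mul_k0 s.rep_spec.1))

theorem trivialCoverClass_mul_simpleAlgHom (v : MonoidAlgebra ℂ (StructureGroup k Λ)) :
    trivialCoverClass k Λ * simpleAlgHom k Λ v =
      simpleAlgHom k Λ v * trivialCoverClass k Λ := by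
  induction v using MonoidAlgebra.induction_on with
  | of s => exact (mul_simpleAlgHom_single s).trans (simpleAlgHom_single_mul s).symm
  | add a b ha hb => rw [map_add, mul_add, add_mul, ha, hb]
  | smul c a ha => rw [map_smul, mul_smul_comm, smul_mul_assoc, ha]

theorem trivialCoverClass_mul_self :
    trivialCoverClass k Λ * trivialCoverClass k Λ =
      simpleAlgHom k Λ (canonicalElementC k Λ) * trivialCoverClass k Λ := by
  let P := projCover (FGMod.trivial k Λ)
  -- This is the series chosen in `dimVector`, so c unfolds to the sum over its factors.
  let σ := (exists_compositionSeries P).choose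
  obtain ⟨hb, ht⟩ := (exists_compositionSeries P).choose_spec
  have h := P.k0_mul_eq_sum P (projCover_projective _) σ hb ht
  let s : Fin σ.length → StructureGroup k Λ := fun i =>
    StructureGroup.mk (P.subquotient (σ i.castSucc) (σ i.succ))
      ((covBy_iff_quot_is_simple (σ.step i).le).mp (σ.step i))
  have hc : canonicalElementC k Λ = ∑ i, MonoidAlgebra.single (s i) 1 := by
    change MonoidAlgebra.mapRingHom _ (Int.castRingHom ℂ) (∑ i, MonoidAlgebra.single (s i) 1) = _
    rw [map_sum]
    simp
  let p : K0p k Λ := ⟨P.k0, Subring.subset_closure ⟨P, Or.inl (projCover_projective _), rfl⟩⟩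
  have hp : p * p = ∑ i, simpleHom (s i) * p := by
    refine Subtype.ext ?_
    rw [Subring.coe_mul, AddSubmonoidClass.coe_finsetSum]
    refine h.trans (Finset.sum_congr rfl fun i _ => ?_)
    rw [Subring.coe_mul]
    exact congrArg (· * P.k0) (StructureGroup.k0_rep_mk _ _).symm
  have hp' : trivialCoverClass k Λ = K0p.toComplex p := rfl
  rw [hp', ← map_mul, hp, hc, map_sum, map_sum, Finset.sum_mul]
  refine Finset.sum_congr rfl fun i _ => ?_
  rw [map_mul, simpleAlgHom_single, one_smul]

theorem complexify_simpleAlgHom_single (φ : K0 k Λ →+ ℤ) (s : StructureGroup k Λ) :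
    complexify φ (simpleAlgHom k Λ (MonoidAlgebra.single s 1)) = φ s.rep.k0 := by
  rw [simpleAlgHom_single, one_smul, complexify_toComplex]
  rfl

theorem eq_zero_of_simpleAlgHom_mul_eq_zero (v : MonoidAlgebra ℂ (StructureGroup k Λ))
    (hv : simpleAlgHom k Λ v * trivialCoverClass k Λ = 0) : v = 0 := by
  refine MonoidAlgebra.ext (Finsupp.ext fun s => ?_)
  -- Among the classes [P_t], φ is nonzero only at t = s, so it reads off the coefficient of s.
  obtain ⟨φ, hφ⟩ := s.exists_top_hom
  let L : MonoidAlgebra ℂ (StructureGroup k Λ) →ₗ[ℂ] ℂ :=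
    complexify φ ∘ₗ LinearMap.mulRight ℂ (trivialCoverClass k Λ) ∘ₗ (simpleAlgHom k Λ).toLinearMap
  have hL : ∀ t, L (MonoidAlgebra.single t 1) = φ (projCover t.rep).k0 := fun t =>
    (congrArg (complexify φ) (simpleAlgHom_single_mul t)).trans (complexify_projClass _ _ _)
  have h := linearMap_apply_eq_coeff_mul L s
    (fun t ht => by rw [hL, (hφ t).mpr ht, Int.cast_zero]) v
  have h0 : L v = 0 := (congrArg (complexify φ) hv).trans (map_zero _)
  rw [h0, hL] at h
  refine (mul_eq_zero.mp h.symm).resolve_right fun h1 => ?_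
  exact (hφ s).mp (Int.cast_eq_zero.mp h1) rfl

/-- If P₁ is not one-dimensional, the multiplicity of s as a direct summand vanishes on all [P_t],
hence on ι(b)p, while on ι(a) it reads off the coefficient of s. -/
theorem trivialCoverClass_eq_one_or :
    trivialCoverClass k Λ = 1 ∨ ∀ a b : MonoidAlgebra ℂ (StructureGroup k Λ),
      simpleAlgHom k Λ a = simpleAlgHom k Λ b * trivialCoverClass k Λ → a = 0 := by
  by_cases hd : Module.finrank k (projCover (FGMod.trivial k Λ)).carrier = 1
  · left
    rw [trivialCoverClass, projClass_eq_toComplex, ← map_one K0p.toComplex]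
    exact congrArg _ (Subtype.ext (k0_projCover_trivial_eq_one hd))
  · right
    intro a b hab
    refine MonoidAlgebra.ext (Finsupp.ext fun s => ?_)
    obtain ⟨φ, hφ, hφP⟩ := s.exists_summand_hom
    let L : MonoidAlgebra ℂ (StructureGroup k Λ) →ₗ[ℂ] ℂ :=
      complexify φ ∘ₗ LinearMap.mulRight ℂ (trivialCoverClass k Λ) ∘ₗ
        (simpleAlgHom k Λ).toLinearMap
    have hL : ∀ t, L (MonoidAlgebra.single t 1) = 0 := fun t =>
      (congrArg (complexify φ) (simpleAlgHom_single_mul t)).trans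
        ((complexify_projClass _ _ _).trans (by rw [hφP hd t, Int.cast_zero]))
    have h0 : L b = 0 := by
      rw [linearMap_apply_eq_coeff_mul L s (fun t _ => hL t), hL, mul_zero]
    have h := linearMap_apply_eq_coeff_mul (complexify φ ∘ₗ (simpleAlgHom k Λ).toLinearMap) s
      (fun t ht => (complexify_simpleAlgHom_single φ t).trans
        (by rw [(hφ t).mpr ht, Int.cast_zero])) a
    have h1 : (complexify φ ∘ₗ (simpleAlgHom k Λ).toLinearMap) a = 0 :=
      (congrArg (complexify φ) hab).trans h0
    rw [h1] at h
    refine (mul_eq_zero.mp h.symm).resolve_right fun h2 => ?_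
    exact (hφ s).mp (Int.cast_eq_zero.mp ((complexify_simpleAlgHom_single φ s).symm.trans h2)) rfl

theorem exists_simpleAlgHom_eq_of_isSemisimple (M : FGMod k Λ)
    (hM : IsSemisimpleModule Λ M.carrier) :
    ∃ a, K0p.toComplex ⟨M.k0, Subring.subset_closure ⟨M, Or.inr hM, rfl⟩⟩ =
      simpleAlgHom k Λ a := by
  -- The closure lives in K₀(Λ), so membership in K₀ᵖ(Λ) is carried along in the induction.
  have key : ∀ x ∈ AddSubmonoid.closure
      {x | ∃ S : FGMod k Λ, IsSimpleModule Λ S.carrier ∧ x = S.k0},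
      ∃ hx : x ∈ K0p k Λ, ∃ a, K0p.toComplex ⟨x, hx⟩ = simpleAlgHom k Λ a := fun x hx => by
    induction hx using AddSubmonoid.closure_induction with
    | mem x hx =>
      obtain ⟨S, hS, rfl⟩ := hx
      refine ⟨Subring.subset_closure ⟨S, Or.inr inferInstance, rfl⟩,
        MonoidAlgebra.single (StructureGroup.mk S hS) 1, ?_⟩
      rw [simpleAlgHom_single, one_smul]
      exact congrArg _ (Subtype.ext (StructureGroup.k0_rep_mk S hS).symm)
    | zero => exact ⟨zero_mem _, 0, by rw [map_zero]; exact map_zero _⟩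
    | add x y _ _ hx hy =>
      obtain ⟨hx, a, ha⟩ := hx
      obtain ⟨hy, b, hb⟩ := hy
      refine ⟨add_mem hx hy, a + b, ?_⟩
      rw [map_add, ← ha, ← hb, ← map_add]
      rfl
  exact (key _ (M.k0_mem_closure_of_isSemisimple hM)).2

theorem exists_projClass_eq (P : FGMod k Λ) (hP : Module.Projective Λ P.carrier) :
    ∃ a, projClass P hP = simpleAlgHom k Λ a * trivialCoverClass k Λ := by
  have key : ∀ x ∈ AddSubmonoid.closure
      {x | ∃ S : FGMod k Λ, IsSimpleModule Λ S.carrier ∧ x = (projCover S).k0},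
      ∃ hx : x ∈ K0p k Λ, ∃ a, K0p.toComplex ⟨x, hx⟩ =
        simpleAlgHom k Λ a * trivialCoverClass k Λ := fun x hx => by
    induction hx using AddSubmonoid.closure_induction with
    | mem x hx =>
      obtain ⟨S, hS, rfl⟩ := hx
      refine ⟨Subring.subset_closure ⟨_, Or.inl (projCover_projective S), rfl⟩,
        MonoidAlgebra.single (StructureGroup.mk S hS) 1, ?_⟩
      rw [simpleAlgHom_single, one_smul, trivialCoverClass, projClass_eq_toComplex, ← map_mul]
      refine congrArg _ (Subtype.ext ?_)
      change _ = (StructureGroup.mk S hS).rep.k0 * _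
      rw [StructureGroup.k0_rep_mk, S.k0_mul_projCover_trivial hS]
    | zero => exact ⟨zero_mem _, 0, by rw [map_zero, zero_mul]; exact map_zero _⟩
    | add x y _ _ hx hy =>
      obtain ⟨hx, a, ha⟩ := hx
      obtain ⟨hy, b, hb⟩ := hy
      refine ⟨add_mem hx hy, a + b, ?_⟩
      rw [map_add, add_mul, ← ha, ← hb, ← map_add]
      rfl
  exact (key _ (P.k0_mem_closure_of_projective hP)).2

variable (k Λ) in
/-- The linear map `ℂ𝒮 → ℂ ⊗ K₀ᵖ(Λ)` with `s ↦ 1 ⊗ [P_s]`. -/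
noncomputable def coverMap : MonoidAlgebra ℂ (StructureGroup k Λ) →ₗ[ℂ] CK0p k Λ :=
  LinearMap.mulRight ℂ (trivialCoverClass k Λ) ∘ₗ (simpleAlgHom k Λ).toLinearMap

theorem coverMap_apply (v : MonoidAlgebra ℂ (StructureGroup k Λ)) :
    coverMap k Λ v = simpleAlgHom k Λ v * trivialCoverClass k Λ := rfl

theorem coverMap_injective : Function.Injective (coverMap k Λ) :=
  (injective_iff_map_eq_zero _).mpr eq_zero_of_simpleAlgHom_mul_eq_zero

theorem range_coverMap : LinearMap.range (coverMap k Λ) = projIdeal k Λ := by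
  refine le_antisymm ?_ (Submodule.span_le.mpr ?_)
  · rintro _ ⟨v, rfl⟩
    induction v using MonoidAlgebra.induction_on with
    | of s =>
      exact Submodule.subset_span ⟨_, projCover_projective s.rep, simpleAlgHom_single_mul s⟩
    | add a b ha hb => rw [map_add]; exact add_mem ha hb
    | smul c a ha => rw [map_smul]; exact Submodule.smul_mem _ _ ha
  · rintro _ ⟨P, hP, rfl⟩
    obtain ⟨a, ha⟩ := exists_projClass_eq P hP
    exact ⟨a, ha.symm⟩

/-- `ℂ ⊗ K₀ᵖ(Λ)` is spanned by the classes of the simple modules and of their projective covers. -/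
theorem exists_eq_simpleAlgHom_add (r : CK0p k Λ) :
    ∃ a b, r = simpleAlgHom k Λ a + simpleAlgHom k Λ b * trivialCoverClass k Λ := by
  have hmem : ∀ (x : K0 k Λ) (hx : x ∈ K0p k Λ), ∃ a b, K0p.toComplex ⟨x, hx⟩ =
      simpleAlgHom k Λ a + simpleAlgHom k Λ b * trivialCoverClass k Λ := fun x hx => by
    induction hx using Subring.closure_induction with
    | mem x hx =>
      obtain ⟨M, hM | hM, rfl⟩ := hx
      · obtain ⟨b, hb⟩ := exists_projClass_eq M hM
        exact ⟨0, b, by rw [map_zero, zero_add]; exact hb⟩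
      · obtain ⟨a, ha⟩ := exists_simpleAlgHom_eq_of_isSemisimple M hM
        exact ⟨a, 0, by rw [map_zero, zero_mul, add_zero]; exact ha⟩
    | zero => exact ⟨0, 0, by rw [map_zero, zero_mul, add_zero]; exact map_zero _⟩
    | one => exact ⟨1, 0, by rw [map_zero, zero_mul, add_zero, map_one]; exact map_one _⟩
    | add x y hx hy ihx ihy =>
      obtain ⟨a, b, h⟩ := ihx
      obtain ⟨a', b', h'⟩ := ihy
      refine ⟨a + a', b + b', ?_⟩
      refine (map_add K0p.toComplex ⟨x, hx⟩ ⟨y, hy⟩).trans ?_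
      rw [h, h', map_add, map_add, add_mul]
      abel
    | neg x hx ih =>
      obtain ⟨a, b, h⟩ := ih
      refine ⟨-a, -b, (map_neg K0p.toComplex ⟨x, hx⟩).trans ?_⟩
      rw [h, map_neg, map_neg]
      refine (neg_add _ _).trans (congrArg _ ?_)
      exact ((coverMap k Λ).map_neg b).symm.trans (by rw [coverMap_apply, map_neg])
    | mul x y hx hy ihx ihy =>
      obtain ⟨a, b, h⟩ := ihx
      obtain ⟨a', b', h'⟩ := ihy
      -- Expand (a + bp)(a' + b'p), moving p to the right and replacing p² by cp.
      refine ⟨a * a', a * b' + b * a' + b * b' * canonicalElementC k Λ, ?_⟩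
      refine (map_mul K0p.toComplex ⟨x, hx⟩ ⟨y, hy⟩).trans ?_
      have h1 := trivialCoverClass_mul_simpleAlgHom (k := k) (Λ := Λ)
      have e1 : ∀ v w : MonoidAlgebra ℂ (StructureGroup k Λ),
          simpleAlgHom k Λ v * trivialCoverClass k Λ * simpleAlgHom k Λ w =
            simpleAlgHom k Λ (v * w) * trivialCoverClass k Λ := fun v w => by
        rw [mul_assoc, h1, ← mul_assoc, ← map_mul]
      have e2 : ∀ v w : MonoidAlgebra ℂ (StructureGroup k Λ),
          simpleAlgHom k Λ v * trivialCoverClass k Λ *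
            (simpleAlgHom k Λ w * trivialCoverClass k Λ) =
            simpleAlgHom k Λ (v * w * canonicalElementC k Λ) * trivialCoverClass k Λ :=
        fun v w => by
          rw [← mul_assoc, e1, mul_assoc, trivialCoverClass_mul_self, ← mul_assoc, ← map_mul]
      rw [h, h', mul_add, add_mul, add_mul, e1, e2, ← mul_assoc (simpleAlgHom k Λ a)]
      simp only [map_add, map_mul, add_mul]
      abel
  induction r using TensorProduct.induction_on with
  | zero => exact ⟨0, 0, by simp⟩
  | tmul c x =>
    obtain ⟨a, b, h⟩ := hmem x.1 x.2
    refine ⟨c • a, c • b, ?_⟩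
    rw [map_smul, map_smul, smul_mul_assoc, ← smul_add, ← h]
    change _ = c • ((1 : ℂ) ⊗ₜ[ℤ] x)
    rw [TensorProduct.smul_tmul', smul_eq_mul, mul_one]
  | add x y hx hy =>
    obtain ⟨a, b, h⟩ := hx
    obtain ⟨a', b', h'⟩ := hy
    refine ⟨a + a', b + b', ?_⟩
    rw [h, h', map_add, map_add, add_mul]
    abel

theorem CK0p_mul_comm (hab : ∀ s t : StructureGroup k Λ, s * t = t * s) (x y : CK0p k Λ) :
    x * y = y * x := by
  obtain ⟨a, b, rfl⟩ := exists_eq_simpleAlgHom_add x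
  obtain ⟨a', b', rfl⟩ := exists_eq_simpleAlgHom_add y
  have hs : ∀ v w, Commute (simpleAlgHom k Λ v) (simpleAlgHom k Λ w) := fun v w => by
    rw [Commute, SemiconjBy, ← map_mul, monoidAlgebra_mul_comm hab, map_mul]
  have hp : ∀ v, Commute (trivialCoverClass k Λ) (simpleAlgHom k Λ v) :=
    trivialCoverClass_mul_simpleAlgHom
  have h1 : ∀ v w w', Commute (simpleAlgHom k Λ v)
      (simpleAlgHom k Λ w + simpleAlgHom k Λ w' * trivialCoverClass k Λ) := fun v w w' =>
    (hs v w).add_right ((hs v w').mul_right (hp v).symm)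
  have h2 : Commute (trivialCoverClass k Λ)
      (simpleAlgHom k Λ a' + simpleAlgHom k Λ b' * trivialCoverClass k Λ) :=
    (hp a').add_right ((hp b').mul_right (Commute.refl _))
  exact (h1 a a' b').add_left ((h1 b a' b').mul_left h2)

/-- We have vp · wp = vwp² = vwcp, and c moves past w because 𝒮 is abelian. -/
theorem coverMap_mul_canonicalElementC_mul (hab : ∀ s t : StructureGroup k Λ, s * t = t * s)
    (v w : MonoidAlgebra ℂ (StructureGroup k Λ)) :
    coverMap k Λ (v * canonicalElementC k Λ * w) = coverMap k Λ v * coverMap k Λ w := by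
  rw [coverMap_apply, coverMap_apply, coverMap_apply, mul_assoc (simpleAlgHom k Λ v),
    ← mul_assoc (trivialCoverClass k Λ), trivialCoverClass_mul_simpleAlgHom, mul_assoc _ _
    (trivialCoverClass k Λ), trivialCoverClass_mul_self, ← mul_assoc, ← mul_assoc, ← map_mul,
    ← map_mul, mul_assoc v, monoidAlgebra_mul_comm hab _ w, mul_assoc v]

theorem mul_mem_projIdeal (hab : ∀ s t : StructureGroup k Λ, s * t = t * s) {x : CK0p k Λ}
    (hx : x ∈ projIdeal k Λ) (y : CK0p k Λ) : y * x ∈ projIdeal k Λ := by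
  rw [← range_coverMap] at hx ⊢
  obtain ⟨v, rfl⟩ := hx
  obtain ⟨a, b, rfl⟩ := exists_eq_simpleAlgHom_add y
  rw [add_mul]
  refine add_mem ⟨a * v, ?_⟩ ⟨b * canonicalElementC k Λ * v, ?_⟩
  · rw [coverMap_apply, coverMap_apply, map_mul, mul_assoc]
  · exact coverMap_mul_canonicalElementC_mul hab b v

theorem isNilpotent_iff_exists_coverMap (hab : ∀ s t : StructureGroup k Λ, s * t = t * s)
    {I : Type*} (X : I → MonoidAlgebra ℂ (StructureGroup k Λ) →ₐ[ℂ] ℂ)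
    (hX : ∀ v, (∀ i, X i v = 0) → v = 0) (r : CK0p k Λ) :
    IsNilpotent r ↔
      ∃ v, (∀ i, X i (canonicalElementC k Λ) ≠ 0 → X i v = 0) ∧ coverMap k Λ v = r := by
  -- Both commutative structures extend the given ring structures, so nilpotency keeps its meaning.
  let _ : CommRing (MonoidAlgebra ℂ (StructureGroup k Λ)) :=
    { (inferInstance : Ring (MonoidAlgebra ℂ (StructureGroup k Λ))) with
      mul_comm := monoidAlgebra_mul_comm hab }
  let _ : CommRing (CK0p k Λ) :=
    { (inferInstance : Ring (CK0p k Λ)) with mul_comm := CK0p_mul_comm hab }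
  exact isNilpotent_iff_of_mul_self_eq (simpleAlgHom k Λ).toRingHom (trivialCoverClass k Λ)
    (canonicalElementC k Λ) (fun i => (X i).toRingHom) hX trivialCoverClass_mul_self
    eq_zero_of_simpleAlgHom_mul_eq_zero (exists_eq_simpleAlgHom_add)
    trivialCoverClass_eq_one_or r

variable (k Λ) in
/-- The linear isomorphism from `ℂ𝒮` to the ideal of the projective modules. -/
noncomputable def coverEquiv : MonoidAlgebra ℂ (StructureGroup k Λ) ≃ₗ[ℂ] projIdeal k Λ :=
  (LinearEquiv.ofInjective (coverMap k Λ) coverMap_injective).trans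
    (LinearEquiv.ofEq _ _ range_coverMap)

end ProjectiveClassRing

end HopfK0

theorem mainTheorem3 {k Λ : Type u} [Field k] [Ring Λ] [HopfAlgebra k Λ] [Module.Finite k Λ]
    [IsBasicSplit k Λ] (hab : ∀ s t : StructureGroup k Λ, s * t = t * s) :
    ∃ hcomm : ∀ x y : CK0p k Λ, x * y = y * x,
      (∀ x ∈ projIdeal k Λ, ∀ y : CK0p k Λ, y * x ∈ projIdeal k Λ ∧ x * y ∈ projIdeal k Λ) ∧
      ∃ Φ : MonoidAlgebra ℂ (StructureGroup k Λ) ≃ₗ[ℂ] projIdeal k Λ,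
        (∀ s : StructureGroup k Λ, (Φ (MonoidAlgebra.single s 1) : CK0p k Λ) =
          projClass (projCover s.rep) (projCover_projective s.rep)) ∧
        (∀ t₁ t₂ : MonoidAlgebra ℂ (StructureGroup k Λ),
          (Φ (t₁ * canonicalElementC k Λ * t₂) : CK0p k Λ) = (Φ t₁ : CK0p k Λ) * Φ t₂) ∧
        ∀ (t : ℕ) (n : Fin t → ℕ) (_ : ∀ i, 0 < n i)
          (e : Multiplicative (∀ i, ZMod (n i)) ≃* StructureGroup k Λ)
          (q : Fin t → ℂ) (_ : ∀ i, IsPrimitiveRoot (q i) (n i)),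
          nilradicalOfComm hcomm =
            (fun v => (Φ v : CK0p k Λ)) ''
              ((fourierForm e q).orthogonal
                (Submodule.span ℂ ((fun x => MonoidAlgebra.single x (1 : ℂ)) ''
                  {x : StructureGroup k Λ |
                    fourierForm e q (MonoidAlgebra.single x 1) (canonicalElementC k Λ) ≠ 0})) :
                Set (MonoidAlgebra ℂ (StructureGroup k Λ))) := by
  refine ⟨CK0p_mul_comm hab, fun x hx y => ⟨mul_mem_projIdeal hab hx y, ?_⟩, coverEquiv k Λ,
    simpleAlgHom_single_mul, coverMap_mul_canonicalElementC_mul hab, ?_⟩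
  · rw [CK0p_mul_comm hab]
    exact mul_mem_projIdeal hab hx y
  · intro t n hn e q hq
    ext r
    refine (isNilpotent_iff_exists_coverMap hab
      (fun g => MonoidAlgebra.lift ℂ ℂ (StructureGroup k Λ) (fourierCharacter hn e q hq g))
      (eq_zero_of_lift_fourierCharacter hn e q hq) r).trans (exists_congr fun v => ?_)
    refine and_congr ?_ Iff.rfl
    rw [SetLike.mem_coe, mem_orthogonal_span_single_iff hn e q hq]
    exact forall_congr' fun g => by rw [Set.mem_ofPred_eq, fourierForm_single hn e q hq]
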